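/- **Setting.** Let $L=K(\eta)$ be a finite simple extension of fields and let $v$ be a valuation of rank one on $L$, so that we may take $vL\subseteq\mathbb R$; let $\Gamma\subseteq\mathbb R$ be the divisible closure of $vL$. Let $\nu$ be the valuation $\nu(f)=v(f(\eta))$ on $K[x]$ and $\overline\nu$ an extension of $\nu$ to $\overline K[x]$, where $\overline K$ is an algebraic closure of $K$. For $f\in K[x]$ put $\epsilon(f)=\max\{\overline\nu(x-a)\mid f(a)=0\}$ (which is $-\infty$ if $f$ is constant). A non-constant monic $Q\in K[x]$ is a *key polynomial* if $\epsilon(f)<\epsilon(Q)$ whenever $\deg f<\deg Q$. Let $\Psi_n$ be the set of key polynomials of degree $n$. Suppose that $\Psi_n$ is a *plateau*, i.e. it is non-empty and $\nu(\Psi_n)$ has no maximum, and that $\nu(\Psi_n)$ is bounded in $\Gamma$. A *limit key polynomial for $\Psi_n$* is a key polynomial of smallest degree larger than $n$; let $F$ be one. For $Q\in\Psi_n$ let $F=\sum_{i=0}^{D}a_{Qi}(F)Q^i$, with $\deg a_{Qi}(F)<n$ and $a_{QD}(F)\ne0$, be the $Q$-expansion of $F$ ($D$ does not depend on $Q$);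 let $L(X)=\sum_i a_{Qi}(F)X^i$, and let $\nu_Q(F)=\min_i\nu(a_{Qi}(F)Q^i)$. Put $B=\sup_{Q\in\Psi_n}\nu(Q)$ and $\overline B=\sup_{Q\in\Psi_n}\nu_Q(F)$. Take $Q_0,Q\in\Psi_n$ with $$\epsilon(Q)-\epsilon(Q_0)>D(B-\nu(Q)),$$ and a well-ordered family $\{Q_\rho\}_{\rho<\lambda}$ in $\Psi_n$ whose values $\gamma_\rho=\nu(Q_\rho)$ are strictly increasing in $\rho$, larger than $\nu(Q)$ and cofinal in $\nu(\Psi_n)$. Let $h_\rho=Q-Q_\rho$ and $\beta_i=\nu(\partial_iL(Q))$, where $\partial_i$ is the $i$-th Hasse derivative in $X$ and $L$ is taken with respect to $Q$. Write $a_{\rho i}=a_{Q_\rho i}$ and $J_\rho(F)=\{j\in\{1,\dots,D\}\mid \nu(a_{\rho j}(F)Q_\rho^j)>\overline B\}$. Call an index $\rho_1$ *large enough* if there is $\rho_0\le\rho_1$ such that for all $\rho\ge\rho_0$ we have $\nu(\partial_iL(h_\rho))=\beta_i$ for $1\le i\le D$, and $\beta_j+j\gamma_\rho\ne\beta_k+k\gamma_\rho$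 for $1\le j<k\le D$ with $\beta_j,\beta_k$ not both infinite; and moreover $J_\rho(F)=J_{\rho_1}(F)$ for all $\rho\ge\rho_1$. Put $B_n(F)=\{1,\dots,D-1\}\setminus J_{\rho_1}(F)$. **Proposition.** For every $Q_0\in\Psi_n$ there is such a $Q$, and for all choices of $Q_0$, $Q$ and $\{Q_\rho\}$ there is a large enough $\rho_1$. For all such choices of $Q_0,Q,\{Q_\rho\},\rho_1$, for every $\rho$ with $\rho_1\le\rho<\lambda$ and every $S\subseteq B_n(F)$, the polynomial $$F_{S,\rho}=a_{\rho0}(F)+\sum_{s\in S}a_{\rho s}(F)Q_\rho^s+a_{\rho D}(F)Q_\rho^D$$ is a limit key polynomial for $\Psi_n$ if and only if $S=B_n(F)$. Moreover, $B_n(F)$ depends neither on these choices nor on $F$: if $H$ is another limit key polynomial for $\Psi_n$, then $B_n(H)=B_n(F)$. -/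

import Mathlib

open Polynomial

namespace LimitKey

section Expansion

variable {K : Type*} [Field K]

/-- The coefficient `a_{Qi}(f)` of the `Q`-expansion of `f`, for `Q` monic of positive degree:
divide `i` times by `Q`, then take the remainder. -/
noncomputable def expCoeff (Q f : K[X]) (i : ℕ) : K[X] :=
  ((fun h : K[X] => h /ₘ Q)^[i] f) %ₘ Q

/-- The polynomial `L(X) = ∑ a_{Qi}(f) X ^ i` over `K[x]`, for which `f = L(Q)`. Its support is the
set `L_Q(f)` of indices of non-zero terms of the `Q`-expansion (no index exceeds `deg f`). -/
noncomputable def expPoly (Q f : K[X]) : K[X][X] :=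
  ∑ i ∈ Finset.range (f.natDegree + 1), monomial i (expCoeff Q f i)

/-- `D = deg_X L`, the largest exponent in the `Q`-expansion of `f`. -/
noncomputable def expDegree (Q f : K[X]) : ℕ := (expPoly Q f).natDegree

theorem natDegree_expCoeff_lt {Q : K[X]} (hQ : Q.Monic) (hd : 0 < Q.natDegree) (f : K[X]) (i : ℕ) :
    (expCoeff Q f i).natDegree < Q.natDegree :=
  natDegree_modByMonic_lt _ hQ (fun h => by simp [h] at hd)

theorem expPoly_eval {Q : K[X]} (hQ : Q.Monic) (hd : 0 < Q.natDegree) (f : K[X]) :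
    (expPoly Q f).eval Q = f := by
  have key : ∀ (m : ℕ) (h : K[X]), h.natDegree < m →
      ∑ i ∈ Finset.range m, expCoeff Q h i * Q ^ i = h := by
    intro m
    induction m with
    | zero => intro h hh; omega
    | succ m ih =>
      intro h hh
      rw [Finset.sum_range_succ']
      have hstep : ∀ i, expCoeff Q h (i + 1) = expCoeff Q (h /ₘ Q) i := fun i => rfl
      simp only [hstep, pow_succ, ← mul_assoc]
      rw [← Finset.sum_mul]
      have h0 : expCoeff Q h 0 = h %ₘ Q := rfl
      rw [h0, pow_zero, mul_one]
      have hsum : ∑ i ∈ Finset.range m, expCoeff Q (h /ₘ Q) i * Q ^ i = h /ₘ Q := by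
        rcases Nat.eq_zero_or_pos m with rfl | hm
        · have : h /ₘ Q = 0 := by
            rw [divByMonic_eq_zero_iff hQ]
            exact degree_lt_degree (by omega)
          simp [this]
        · apply ih
          rw [natDegree_divByMonic _ hQ]
          omega
      rw [hsum, mul_comm, add_comm]
      exact modByMonic_add_div h Q
  rw [expPoly, eval_finsetSum]
  simp only [eval_monomial]
  exact key _ f (Nat.lt_succ_self _)

variable (ν : AddValuation K[X] (WithTop ℝ))

/-- The truncation `ν_Q(f) = min { ν (a_{Qi}(f) Q ^ i) | i ∈ L_Q(f) }` (so `ν_Q(0) = ∞`). -/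
noncomputable def truncation (Q f : K[X]) : WithTop ℝ :=
  (expPoly Q f).support.inf fun i => ν ((expPoly Q f).coeff i * Q ^ i)

/-- `F_{S,Q} = a_{Q0}(F) + ∑_{s ∈ S} a_{Qs}(F) Q ^ s + a_{QD}(F) Q ^ D`. -/
noncomputable def truncExpansion (F Q : K[X]) (S : Finset ℕ) : K[X] :=
  (expPoly Q F).coeff 0 + ∑ s ∈ S, (expPoly Q F).coeff s * Q ^ s
    + (expPoly Q F).coeff (expDegree Q F) * Q ^ expDegree Q F

/-- `β_i = ν (∂_i L (Q))`, where `F = L(Q)` and `∂_i` is the `i`-th Hasse derivative. -/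
noncomputable def beta (F Q : K[X]) (i : ℕ) : WithTop ℝ :=
  ν ((hasseDeriv i (expPoly Q F)).eval Q)

end Expansion

/-- Extended real values; `EReal` is by definition `WithBot (WithTop ℝ)`. -/
def toE (x : WithTop ℝ) : EReal := WithBot.some x

section Valued

variable {K L : Type*} [Field K] [Field L] [Algebra K L]

/-- The valuation `f ↦ v (f(η))` on `K[x]`. Its support is generated by the minimal polynomial `g`
of `η`, and `f(η) = f₀(η)` for the remainder `f₀` of `f` modulo `g`. -/
noncomputable def inducedVal (v : AddValuation L (WithTop ℝ)) (η : L) :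
    AddValuation K[X] (WithTop ℝ) :=
  v.comap (aeval (R := K) η : K[X] →ₐ[K] L).toRingHom

/-- The divisible closure `Γ` of the value group of `v`, inside `ℝ`. -/
def divisibleClosure (v : AddValuation L (WithTop ℝ)) : Set ℝ :=
  {γ | ∃ m : ℕ, 0 < m ∧ ∃ y : L, v y = ((m * γ : ℝ) : WithTop ℝ)}

end Valued

section KeyPolynomials

variable {K Kbar : Type*} [Field K] [Field Kbar] [Algebra K Kbar]

/-- `ε(f) = max { νbar (x - a) | a a root of f }`, which is `⊥ = -∞` if `f` is constant. -/
noncomputable def eps (νbar : AddValuation Kbar[X] (WithTop ℝ)) (f : K[X]) : EReal :=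
  ((f.aroots Kbar).map fun a => toE (νbar (X - C a))).sup

/-- Key polynomials: monic, non-constant, and `ε(f) < ε(Q)` whenever `deg f < deg Q`. -/
def IsKeyPolynomial (νbar : AddValuation Kbar[X] (WithTop ℝ)) (Q : K[X]) : Prop :=
  Q.Monic ∧ 0 < Q.natDegree ∧
    ∀ f : K[X], f.natDegree < Q.natDegree → eps νbar f < eps νbar Q

/-- The set `Ψ_n` of key polynomials of degree `n`. -/
def Psi (K : Type*) [Field K] [Algebra K Kbar] (νbar : AddValuation Kbar[X] (WithTop ℝ)) (n : ℕ) :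
    Set K[X] :=
  {Q | IsKeyPolynomial νbar Q ∧ Q.natDegree = n}

variable (ν : AddValuation K[X] (WithTop ℝ)) (νbar : AddValuation Kbar[X] (WithTop ℝ)) (n : ℕ)

/-- `Ψ_n` is a plateau: it is non-empty and `ν(Ψ_n)` has no maximum. -/
def IsPlateau : Prop :=
  (Psi K νbar n).Nonempty ∧ ¬ ∃ Q ∈ Psi K νbar n, ∀ Q' ∈ Psi K νbar n, ν Q' ≤ ν Q

/-- `ν(Ψ_n)` is bounded above by an element of `Γ`. -/
def IsBoundedIn (Γ : Set ℝ) : Prop :=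
  ∃ γ ∈ Γ, ∀ Q ∈ Psi K νbar n, ν Q ≤ (γ : WithTop ℝ)

/-- `KP(Ψ_n)`: key polynomials of smallest degree larger than `n`. -/
def IsKeyPolynomialFor (F : K[X]) : Prop :=
  IsKeyPolynomial νbar F ∧ n < F.natDegree ∧
    ∀ G : K[X], IsKeyPolynomial νbar G → n < G.natDegree → F.natDegree ≤ G.natDegree

/-- Limit key polynomials for `Ψ_n`. -/
def IsLimitKeyPolynomial (F : K[X]) : Prop :=
  IsPlateau ν νbar n ∧ IsKeyPolynomialFor νbar n F

/-- `B = lim ν(Q) = sup ν(Q)` over `Q ∈ Ψ_n`. -/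
noncomputable def limitValue : EReal := ⨆ Q ∈ Psi K νbar n, toE (ν Q)

/-- `Bbar = lim ν_Q(F) = sup ν_Q(F)` over `Q ∈ Ψ_n`. -/
noncomputable def limitTrunc (F : K[X]) : EReal := ⨆ Q ∈ Psi K νbar n, toE (truncation ν Q F)

/-- `Q₀, Q ∈ Ψ_n` and `ε(Q) - ε(Q₀) > D (B - ν(Q))`. -/
def IsBase (F Q₀ Q : K[X]) : Prop :=
  Q₀ ∈ Psi K νbar n ∧ Q ∈ Psi K νbar n ∧
    eps νbar Q - eps νbar Q₀ > (expDegree Q F : EReal) * (limitValue ν νbar n - toE (ν Q))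

/-- A well-ordered family in `Ψ_n` with increasing values, all larger than `ν(Q)` and cofinal
in `ν(Ψ_n)`. -/
def IsCofinalFamily {ι : Type*} [LinearOrder ι] (Q : K[X]) (q : ι → K[X]) : Prop :=
  WellFoundedLT ι ∧ (∀ ρ, q ρ ∈ Psi K νbar n) ∧ StrictMono (fun ρ => ν (q ρ)) ∧
    (∀ ρ, ν Q < ν (q ρ)) ∧ ∀ P ∈ Psi K νbar n, ∃ ρ, ν P ≤ ν (q ρ)

open Classical in
/-- `J_P(F)`: the `j ∈ {1, …, D}` with `ν (a_{Pj}(F) P ^ j) > Bbar`. -/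
noncomputable def J (F P : K[X]) : Finset ℕ :=
  (Finset.Icc 1 (expDegree P F)).filter fun j =>
    toE (ν ((expPoly P F).coeff j * P ^ j)) > limitTrunc ν νbar n F

/-- `{1, …, D - 1} \ J_P(F)`; this is `B_n(F)` when `P` is the member `Q_{ρ₁}` of the family. -/
noncomputable def Bset (F P : K[X]) : Finset ℕ :=
  Finset.Ico 1 (expDegree P F) \ J ν νbar n F P

/-- The requirements on the index `ρ₀`: for all `ρ ≥ ρ₀`, `β_i = ν (∂_i L (h_ρ))` with
`h_ρ = Q - Q_ρ` for `1 ≤ i ≤ D`, and `β_j + j γ_ρ ≠ β_k + k γ_ρ` for `1 ≤ j < k ≤ D` (unless both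
sides are infinite, which happens when `∂_j L = ∂_k L = 0`). -/
def IsFirstThreshold {ι : Type*} [LinearOrder ι] (F Q : K[X]) (q : ι → K[X]) (ρ₀ : ι) : Prop :=
  (∀ ρ, ρ₀ ≤ ρ → ∀ i, 1 ≤ i → i ≤ expDegree Q F →
    beta ν F Q i = ν ((hasseDeriv i (expPoly Q F)).eval (Q - q ρ))) ∧
  (∀ ρ, ρ₀ ≤ ρ → ∀ j k, 1 ≤ j → j < k → k ≤ expDegree Q F →
    (beta ν F Q j ≠ ⊤ ∨ beta ν F Q k ≠ ⊤) →
    beta ν F Q j + j • ν (q ρ) ≠ beta ν F Q k + k • ν (q ρ))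

/-- The requirements on the index `ρ₁`: it is at least some `ρ₀` as above, and `J_ρ(F) = J_{ρ₁}(F)`
for all `ρ ≥ ρ₁`. -/
def IsThreshold {ι : Type*} [LinearOrder ι] (F Q : K[X]) (q : ι → K[X]) (ρ₁ : ι) : Prop :=
  (∃ ρ₀, ρ₀ ≤ ρ₁ ∧ IsFirstThreshold ν F Q q ρ₀) ∧
    ∀ ρ, ρ₁ ≤ ρ → J ν νbar n F (q ρ) = J ν νbar n F (q ρ₁)

end KeyPolynomials

end LimitKey

namespace LimitKey

/-! ### Gauss valuations over an algebraically closed field. -/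

section Gauss

variable {E : Type*} [Field E]

/-! The proof works with Gauss valuations over the algebraic closure. Let `P` be a key polynomial of
finite value and `a` a root of it with `V (X - a) = ε(P)`. The Gauss valuation with centre `a` and
radius `ε(P)` sends `X - b` to `min (ε(P)) (V (X - b))`, and its restriction to `K[X]` is the
truncation ν_P (`truncation_eq`). Hence ν_P is a valuation, is at most ν, grows with `ε(P)`, and
agrees with ν at `f` once `ε(f) ≤ ε(P)`. This happens far out in Ψ_n for every `f` of degree below
`deg F` (`exists_eps_le`), whereas ν_P(F) keeps increasing towards B̄ and ν(F) ≥ B̄.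

To follow the coefficients of `F`, fix `Q`, let `P` in Ψ_n have larger value and put `u = Q - P`.
Taylor's formula gives F = L(u + P) = ∑ ∂_jL(u) P^j, which differs from the `P`-expansion only
because ∂_jL(u) may have degree at least n. Reducing modulo `P` produces errors whose value is
larger than that of the terms by at least ε(P) - ε(Q₀) (`add_rad_sub_le_truncVal`), while
truncations of `F` can grow by at most D(B - ν(Q)) beyond `Q`. The inequality defining `Q` makes the
errors negligible. So, for `P` of large value, the i-th term of the `P`-expansion has value β_i +
iν(P), unless both quantities exceed B̄ (`map_coeff_eq_or`). These are lines in ν(P) of different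
slopes: the sets J_P(F) stabilise, and the finite ones take distinct values.

Omitting terms of value above B̄ from `F` leaves a polynomial `G` with the truncations of `F` far
out and with ν(G) ≥ B̄, so ε(G) exceeds every ε(Q), and `G` is again a limit key polynomial.
Conversely, two limit key polynomials differ by an element of value at least B̄
(`supTrunc_le_map_sub`), whereas omitted terms with exponents in B_n(F) have distinct values below
B̄, which cannot cancel. The same bound, read coefficientwise on `F - H`, shows that B_n(F) =
B_n(H). -/

theorem add_lt_add_of_shift {a b x y : WithTop ℝ} {r s t u : ℝ} (hb : b ≠ ⊤)
    (h₁ : a + (r : WithTop ℝ) < x + (s : WithTop ℝ))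
    (h₂ : b + (t : WithTop ℝ) ≤ y + (u : WithTop ℝ)) (h : r + t = s + u) : a + b < x + y := by
  have ha : a ≠ ⊤ := by rintro rfl; simp at h₁
  lift a to ℝ using ha
  lift b to ℝ using hb
  induction x with
  | top => simp
  | coe x =>
    induction y with
    | top => simp
    | coe y =>
      norm_cast at *
      linarith

/-- The minimum of `w (c_i) + i δ` over the coefficients `c_i` of a polynomial. -/
noncomputable def gaussFun (w : AddValuation E (WithTop ℝ)) (δ : ℝ) (p : E[X]) : WithTop ℝ :=
  p.support.inf fun i => w (p.coeff i) + ((i * δ : ℝ) : WithTop ℝ)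

variable (w : AddValuation E (WithTop ℝ)) (δ : ℝ)

theorem le_gaussFun {p : E[X]} {c : WithTop ℝ} :
    c ≤ gaussFun w δ p ↔ ∀ i : ℕ, c ≤ w (p.coeff i) + ((i * δ : ℝ) : WithTop ℝ) := by
  rw [gaussFun, Finset.le_inf_iff]
  refine ⟨fun h i => ?_, fun h i _ => h i⟩
  by_cases hi : i ∈ p.support
  · exact h i hi
  · simp [notMem_support_iff.1 hi]

theorem gaussFun_le (p : E[X]) (i : ℕ) :
    gaussFun w δ p ≤ w (p.coeff i) + ((i * δ : ℝ) : WithTop ℝ) :=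
  (le_gaussFun w δ).1 le_rfl i

theorem exists_gaussFun_eq {p : E[X]} (hp : p ≠ 0) :
    ∃ i : ℕ, p.coeff i ≠ 0 ∧ gaussFun w δ p = w (p.coeff i) + ((i * δ : ℝ) : WithTop ℝ) ∧
      ∀ k < i, gaussFun w δ p < w (p.coeff k) + ((k * δ : ℝ) : WithTop ℝ) := by
  classical
  obtain ⟨j, hj, hje⟩ := Finset.exists_mem_eq_inf p.support (nonempty_support_iff.2 hp)
    fun i => w (p.coeff i) + ((i * δ : ℝ) : WithTop ℝ)
  have hex : ∃ i : ℕ, p.coeff i ≠ 0 ∧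
      gaussFun w δ p = w (p.coeff i) + ((i * δ : ℝ) : WithTop ℝ) :=
    ⟨j, mem_support_iff.1 hj, hje⟩
  refine ⟨Nat.find hex, (Nat.find_spec hex).1, (Nat.find_spec hex).2, fun k hk => ?_⟩
  refine lt_of_le_of_ne (gaussFun_le w δ p k) fun he => ?_
  have h0 := Nat.find_min hex hk
  have hk0 : p.coeff k = 0 := by
    by_contra h
    exact h0 ⟨h, he⟩
  rw [(Nat.find_spec hex).2, hk0, AddValuation.map_zero, top_add] at he
  exact WithTop.add_ne_top.2 ⟨(AddValuation.ne_top_iff w).2 (Nat.find_spec hex).1,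
    WithTop.coe_ne_top⟩ he

theorem gaussFun_ne_top {p : E[X]} (hp : p ≠ 0) : gaussFun w δ p ≠ ⊤ := by
  obtain ⟨i, hi, he, -⟩ := exists_gaussFun_eq w δ hp
  rw [he]
  exact WithTop.add_ne_top.2 ⟨(AddValuation.ne_top_iff w).2 hi, WithTop.coe_ne_top⟩

theorem gaussFun_zero : gaussFun w δ 0 = ⊤ := by simp [gaussFun]

/-- Gauss's lemma. If `i` and `j` are the first indices at which the minima are attained, then in
the coefficient of index `i + j` every product other than `p_i q_j` has strictly larger value. -/
theorem gaussFun_mul (p q : E[X]) : gaussFun w δ (p * q) = gaussFun w δ p + gaussFun w δ q := by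
  rcases eq_or_ne p 0 with rfl | hp
  · simp [gaussFun_zero]
  rcases eq_or_ne q 0 with rfl | hq
  · simp [gaussFun_zero]
  apply le_antisymm
  · obtain ⟨i, hi, hie, hil⟩ := exists_gaussFun_eq w δ hp
    obtain ⟨j, hj, hje, hjl⟩ := exists_gaussFun_eq w δ hq
    have hwi : w (p.coeff i) ≠ ⊤ := (AddValuation.ne_top_iff w).2 hi
    have hwj : w (q.coeff j) ≠ ⊤ := (AddValuation.ne_top_iff w).2 hj
    have hval : w ((p * q).coeff (i + j)) = w (p.coeff i) + w (q.coeff j) := by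
      rw [coeff_mul, ← Finset.add_sum_erase _ _ (a := (i, j)) (by simp), ← AddValuation.map_mul]
      apply AddValuation.map_add_eq_of_lt_left
      apply AddValuation.map_lt_sum
      · rw [AddValuation.map_mul]
        exact WithTop.add_ne_top.2 ⟨hwi, hwj⟩
      · rintro ⟨k, l⟩ hkl
        rw [Finset.mem_erase, Finset.HasAntidiagonal.mem_antidiagonal] at hkl
        obtain ⟨hne, hsum⟩ := hkl
        simp only at hsum
        have hsum' : (k : ℝ) + l = i + j := by exact_mod_cast hsum
        rw [AddValuation.map_mul, AddValuation.map_mul]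
        rcases lt_or_ge k i with hki | hki
        · refine add_lt_add_of_shift hwj (r := i * δ) (s := k * δ) (t := j * δ)
            (u := l * δ) (hie ▸ hil k hki) (hje ▸ gaussFun_le w δ q l) ?_
          rw [← add_mul, ← add_mul, hsum']
        · have hlj : l < j := by
            rcases eq_or_lt_of_le hki with h | h
            · subst h
              have : l = j := by omega
              subst this
              exact absurd rfl hne
            · omega
          rw [add_comm (w _), add_comm (w (p.coeff k))]
          refine add_lt_add_of_shift hwi (r := j * δ) (s := l * δ) (t := i * δ)
            (u := k * δ) (hje ▸ hjl l hlj) (hie ▸ gaussFun_le w δ p k) ?_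
          rw [← add_mul, ← add_mul, add_comm, ← hsum', add_comm]
    refine (gaussFun_le w δ _ (i + j)).trans (le_of_eq ?_)
    rw [hval, hie, hje, Nat.cast_add, add_mul, WithTop.coe_add]
    abel
  · rw [le_gaussFun]
    intro m
    have h : ∀ x ∈ Finset.HasAntidiagonal.antidiagonal m, gaussFun w δ p + gaussFun w δ q ≤
        w (p.coeff x.1 * q.coeff x.2) + ((m * δ : ℝ) : WithTop ℝ) := by
      rintro ⟨k, l⟩ hkl
      rw [Finset.HasAntidiagonal.mem_antidiagonal] at hkl
      simp only at hkl
      subst hkl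
      refine (add_le_add (gaussFun_le w δ p k) (gaussFun_le w δ q l)).trans (le_of_eq ?_)
      rw [AddValuation.map_mul, Nat.cast_add, add_mul, WithTop.coe_add]
      abel
    -- The shift `m * δ` has to be moved to the other side before the sum over the antidiagonal can
    -- be bounded; `WithTop ℝ` has no subtraction, so its negative is added.
    have hr : ∀ x : WithTop ℝ, gaussFun w δ p + gaussFun w δ q ≤ x + ((m * δ : ℝ) : WithTop ℝ) ↔
        gaussFun w δ p + gaussFun w δ q + ((-(m * δ) : ℝ) : WithTop ℝ) ≤ x := by
      intro x
      lift gaussFun w δ p to ℝ using gaussFun_ne_top w δ hp with P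
      lift gaussFun w δ q to ℝ using gaussFun_ne_top w δ hq with Q
      induction x with
      | top => simp
      | coe x => norm_cast; constructor <;> intro h <;> linarith
    rw [hr, coeff_mul]
    exact AddValuation.map_le_sum _ fun x hx => (hr _).1 (h x hx)

theorem gaussFun_add (p q : E[X]) :
    min (gaussFun w δ p) (gaussFun w δ q) ≤ gaussFun w δ (p + q) := by
  rw [le_gaussFun]
  intro i
  rw [coeff_add]
  rcases AddValuation.map_add' w (p.coeff i) (q.coeff i) with h | h
  · exact (min_le_left _ _).trans ((gaussFun_le w δ p i).trans (by gcongr))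
  · exact (min_le_right _ _).trans ((gaussFun_le w δ q i).trans (by gcongr))

theorem gaussFun_C (c : E) : gaussFun w δ (C c) = w c := by
  apply le_antisymm
  · simpa using gaussFun_le w δ (C c) 0
  · rw [le_gaussFun]
    intro i
    rw [coeff_C]
    split_ifs with h
    · simp [h]
    · simp

variable (V : AddValuation E[X] (WithTop ℝ)) (a : E)

/-- The Gauss valuation with centre `a` and radius `δ`. -/
noncomputable def gaussVal : AddValuation E[X] (WithTop ℝ) :=
  (AddValuation.of (gaussFun (V.comap C) δ) (gaussFun_zero _ _)
    (by rw [← C_1, gaussFun_C, AddValuation.map_one]) (gaussFun_add _ _) (gaussFun_mul _ _)).comap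
      (taylorAlgHom a).toRingHom

theorem gaussVal_apply (f : E[X]) :
    gaussVal δ V a f = gaussFun (V.comap C) δ (taylor a f) := rfl

theorem gaussVal_ne_top {f : E[X]} (hf : f ≠ 0) : gaussVal δ V a f ≠ ⊤ :=
  gaussFun_ne_top _ _ fun h => hf ((taylor_eq_zero a f).1 h)

theorem gaussVal_C (c : E) : gaussVal δ V a (C c) = V (C c) := by
  rw [gaussVal_apply, taylor_C, gaussFun_C]
  rfl

theorem gaussVal_le_eval (f : E[X]) : gaussVal δ V a f ≤ V (C (f.eval a)) := by
  have := gaussFun_le (V.comap C) δ (taylor a f) 0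
  rw [taylor_coeff_zero] at this
  simp only [Nat.cast_zero, zero_mul, WithTop.coe_zero, add_zero] at this
  exact this

theorem gaussVal_X_sub_C (b : E) :
    gaussVal δ V a (X - C b) = min (δ : WithTop ℝ) (V (C (a - b))) := by
  have ht : taylor a (X - C b) = X + C (a - b) := by
    rw [_root_.map_sub, taylor_X, taylor_C, C_sub]; ring
  rw [gaussVal_apply, ht]
  apply le_antisymm
  · refine le_min ?_ ?_
    · have := gaussFun_le (V.comap C) δ (X + C (a - b)) 1
      simpa only [coeff_add, coeff_X_one, coeff_C_succ, add_zero, AddValuation.map_one, zero_add,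
        Nat.cast_one, one_mul] using this
    · have := gaussFun_le (V.comap C) δ (X + C (a - b)) 0
      simp only [coeff_add, coeff_X_zero, zero_add, coeff_C_zero, Nat.cast_zero, zero_mul,
        WithTop.coe_zero, add_zero] at this
      exact this
  · refine le_trans ?_ (gaussFun_add _ _ _ _)
    rw [gaussFun_C]
    refine min_le_min ?_ le_rfl
    rw [le_gaussFun]
    intro i
    rw [coeff_X]
    split_ifs with h
    · simp [← h]
    · simp

theorem map_C_sub (b : E) : V (C (a - b)) = V ((X - C b) - (X - C a)) := by
  congr 1
  rw [C_sub]; ring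

variable {δ V a}

/-- When `X - C a` has value at least the radius, the value of a linear factor no longer involves
`a`. By factorisation the whole valuation depends only on `δ`, so different centres can be compared.
-/
theorem gaussVal_X_sub_C_of_le (ha : (δ : WithTop ℝ) ≤ V (X - C a)) (b : E) :
    gaussVal δ V a (X - C b) = min (δ : WithTop ℝ) (V (X - C b)) := by
  rw [gaussVal_X_sub_C, map_C_sub]
  apply le_antisymm
  · refine le_min (min_le_left _ _) ?_
    have := V.map_add ((X - C b) - (X - C a)) (X - C a)
    rw [sub_add_cancel] at this
    refine le_trans ?_ this
    rw [min_comm]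
    exact min_le_min le_rfl ha
  · refine le_min (min_le_left _ _) ?_
    rw [min_comm]
    exact (min_le_min le_rfl ha).trans (V.map_sub _ _)

variable [IsAlgClosed E]

theorem map_eq_sum_roots (W : AddValuation E[X] (WithTop ℝ)) (f : E[X]) :
    W f = W (C f.leadingCoeff) + (f.roots.map fun b => W (X - C b)).sum := by
  conv_lhs => rw [(IsAlgClosed.splits f).eq_prod_roots]
  rw [AddValuation.map_mul]
  congr 1
  induction f.roots using Multiset.induction_on with
  | empty => simp
  | cons b s ih => simp [ih]

theorem gaussVal_eq_sum_roots (ha : (δ : WithTop ℝ) ≤ V (X - C a)) (f : E[X]) :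
    gaussVal δ V a f =
      V (C f.leadingCoeff) + (f.roots.map fun b => min (δ : WithTop ℝ) (V (X - C b))).sum := by
  rw [map_eq_sum_roots, gaussVal_C]
  congr 2
  exact Multiset.map_congr rfl fun b _ => gaussVal_X_sub_C_of_le ha b

theorem gaussVal_mono {δ' : ℝ} {a' : E} (ha : (δ : WithTop ℝ) ≤ V (X - C a))
    (ha' : (δ' : WithTop ℝ) ≤ V (X - C a')) (h : δ ≤ δ') (f : E[X]) :
    gaussVal δ V a f ≤ gaussVal δ' V a' f := by
  rw [gaussVal_eq_sum_roots ha, gaussVal_eq_sum_roots ha']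
  gcongr
  apply Multiset.sum_map_le_sum_map
  intro b _
  gcongr
  exact_mod_cast h

theorem gaussVal_le (ha : (δ : WithTop ℝ) ≤ V (X - C a)) (f : E[X]) : gaussVal δ V a f ≤ V f := by
  rw [gaussVal_eq_sum_roots ha, map_eq_sum_roots V f]
  gcongr
  exact Multiset.sum_map_le_sum_map _ _ fun b _ => min_le_right _ _

theorem gaussVal_eq (ha : (δ : WithTop ℝ) ≤ V (X - C a)) {f : E[X]}
    (hf : ∀ b ∈ f.roots, V (X - C b) ≤ δ) : gaussVal δ V a f = V f := by
  rw [gaussVal_eq_sum_roots ha, map_eq_sum_roots V f]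
  congr 2
  exact Multiset.map_congr rfl fun b hb => min_eq_right (hf b hb)

/-- Each factor `a - b` is the difference of `X - b` and `X - a`, of which the first has strictly
smaller value. -/
theorem map_eval_of_roots_lt {f : E[X]} (hf : ∀ b ∈ f.roots, V (X - C b) < V (X - C a)) :
    V (C (f.eval a)) = V f := by
  conv_lhs => rw [(IsAlgClosed.splits f).eq_prod_roots]
  rw [map_eq_sum_roots V f, eval_mul, eval_C, eval_multiset_prod, C_mul, AddValuation.map_mul]
  congr 1
  revert hf
  induction f.roots using Multiset.induction_on with
  | empty => simp
  | cons b s ih =>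
    intro hf
    simp only [Multiset.map_cons, Multiset.prod_cons, Multiset.sum_cons, C_mul,
      AddValuation.map_mul]
    rw [ih fun b hb => hf b (Multiset.mem_cons_of_mem hb)]
    congr 1
    simp only [eval_sub, eval_X, eval_C]
    rw [map_C_sub]
    exact V.map_sub_eq_of_lt_left (hf b (Multiset.mem_cons_self _ _))

/-- A root `b` of `f` with `V (X - b) > δ` makes the value of `f` drop by at least the
difference. -/
theorem gaussVal_add_le {b : E} {δ' : ℝ} (ha : (δ : WithTop ℝ) ≤ V (X - C a)) {f : E[X]}
    (hb : f.IsRoot b) (hb' : (δ' : WithTop ℝ) ≤ V (X - C b)) :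
    gaussVal δ V a f + (δ' : WithTop ℝ) ≤ V f + (δ : WithTop ℝ) := by
  obtain ⟨g, rfl⟩ := dvd_iff_isRoot.2 hb
  rw [AddValuation.map_mul, AddValuation.map_mul, gaussVal_X_sub_C_of_le ha]
  calc min (δ : WithTop ℝ) (V (X - C b)) + gaussVal δ V a g + (δ' : WithTop ℝ)
      ≤ δ + V g + V (X - C b) := by
        gcongr
        · exact min_le_left _ _
        · exact gaussVal_le ha g
    _ = V (X - C b) + V g + δ := by abel

end Gauss

/-! ### Existence, uniqueness and degrees of `Q`-expansions. -/

section ExpansionLemmas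

variable {K : Type*} [Field K] {Q : K[X]}

theorem natDegree_iterate_divByMonic (hQ : Q.Monic) (f : K[X]) (i : ℕ) :
    ((fun h : K[X] => h /ₘ Q)^[i] f).natDegree = f.natDegree - i * Q.natDegree := by
  induction i with
  | zero => simp
  | succ i ih =>
    rw [Function.iterate_succ_apply', natDegree_divByMonic _ hQ, ih, Nat.sub_sub, add_mul, one_mul]

theorem expCoeff_eq_zero (hQ : Q.Monic) {f : K[X]} {i : ℕ}
    (h : f.natDegree < i * Q.natDegree) : expCoeff Q f i = 0 := by
  obtain ⟨j, rfl⟩ : ∃ j, i = j + 1 := ⟨i - 1, by rcases i with _ | i <;> simp at h ⊢⟩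
  have hd : 0 < Q.natDegree := by
    rcases Nat.eq_zero_or_pos Q.natDegree with h0 | h0
    · simp [h0] at h
    · exact h0
  have : (fun h : K[X] => h /ₘ Q)^[j + 1] f = 0 := by
    rw [Function.iterate_succ_apply', divByMonic_eq_zero_iff hQ]
    apply degree_lt_degree
    rw [natDegree_iterate_divByMonic hQ]
    rw [add_mul, one_mul] at h
    omega
  rw [expCoeff, this, zero_modByMonic]

theorem coeff_expPoly (hQ : Q.Monic) (hd : 0 < Q.natDegree) (f : K[X]) (i : ℕ) :
    (expPoly Q f).coeff i = expCoeff Q f i := by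
  rw [expPoly, finsetSum_coeff]
  simp only [coeff_monomial]
  rw [Finset.sum_ite_eq' (Finset.range (f.natDegree + 1)) i]
  split_ifs with h
  · rfl
  · rw [Finset.mem_range, not_lt] at h
    rw [expCoeff_eq_zero hQ]
    nlinarith

theorem natDegree_coeff_expPoly_lt (hQ : Q.Monic) (hd : 0 < Q.natDegree) (f : K[X]) (i : ℕ) :
    ((expPoly Q f).coeff i).natDegree < Q.natDegree := by
  rw [coeff_expPoly hQ hd]
  exact natDegree_expCoeff_lt hQ hd f i

theorem coeff_expPoly_eq_zero (hQ : Q.Monic) (hd : 0 < Q.natDegree) {f : K[X]} {i : ℕ}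
    (h : f.natDegree < i * Q.natDegree) : (expPoly Q f).coeff i = 0 := by
  rw [coeff_expPoly hQ hd, expCoeff_eq_zero hQ h]

/-- Uniqueness of the expansion: writing `M = M.divX * X + M.coeff 0`, division of `M(Q)` by `Q` has
remainder `M.coeff 0` and quotient `M.divX` evaluated at `Q`. -/
theorem expPoly_eval_eq (hQ : Q.Monic) (hd : 0 < Q.natDegree) {M : K[X][X]}
    (hM : ∀ i, (M.coeff i).natDegree < Q.natDegree) : expPoly Q (M.eval Q) = M := by
  have key : ∀ (i : ℕ) (M : K[X][X]), (∀ i, (M.coeff i).natDegree < Q.natDegree) →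
      expCoeff Q (M.eval Q) i = M.coeff i := by
    intro i
    induction i with
    | zero =>
      intro M hM
      change M.eval Q %ₘ Q = M.coeff 0
      refine (div_modByMonic_unique (M.divX.eval Q) (M.coeff 0) hQ
        ⟨?_, degree_lt_degree (hM 0)⟩).2
      conv_rhs => rw [← divX_mul_X_add M]
      simp only [eval_add, eval_mul, eval_X, eval_C]
      ring
    | succ i ih =>
      intro M hM
      have hdiv : M.eval Q /ₘ Q = M.divX.eval Q := by
        refine (div_modByMonic_unique (M.divX.eval Q) (M.coeff 0) hQ
          ⟨?_, degree_lt_degree (hM 0)⟩).1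
        conv_rhs => rw [← divX_mul_X_add M]
        simp only [eval_add, eval_mul, eval_X, eval_C]
        ring
      have hstep : expCoeff Q (M.eval Q) (i + 1) = expCoeff Q (M.eval Q /ₘ Q) i := rfl
      rw [hstep, hdiv, ih _ fun j => by rw [coeff_divX]; exact hM _, coeff_divX]
  ext1 i
  rw [coeff_expPoly hQ hd, key i M hM]

theorem expPoly_sub (hQ : Q.Monic) (hd : 0 < Q.natDegree) (f g : K[X]) :
    expPoly Q (f - g) = expPoly Q f - expPoly Q g := by
  conv_lhs => rw [← expPoly_eval hQ hd f, ← expPoly_eval hQ hd g, ← eval_sub]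
  refine expPoly_eval_eq hQ hd fun i => ?_
  rw [coeff_sub]
  exact (natDegree_sub_le _ _).trans_lt (max_lt (natDegree_coeff_expPoly_lt hQ hd f i)
    (natDegree_coeff_expPoly_lt hQ hd g i))

theorem expPoly_of_natDegree_lt (hQ : Q.Monic) {f : K[X]} (hf : f.natDegree < Q.natDegree) :
    expPoly Q f = C f := by
  have hd : 0 < Q.natDegree := by omega
  conv_lhs => rw [← eval_C (x := Q) (a := f)]
  refine expPoly_eval_eq hQ hd fun i => ?_
  rw [coeff_C]
  split_ifs
  · exact hf
  · simpa using hd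

theorem expDegree_eq (hQ : Q.Monic) (hd : 0 < Q.natDegree) {f : K[X]} (hf : f ≠ 0) :
    expDegree Q f = f.natDegree / Q.natDegree := by
  set D := f.natDegree / Q.natDegree with hD
  have hne : ∀ i ≤ D, (fun h : K[X] => h /ₘ Q)^[i] f ≠ 0 := by
    intro i
    induction i with
    | zero => intro _; exact hf
    | succ i ih =>
      intro hi
      rw [Function.iterate_succ_apply', Ne, divByMonic_eq_zero_iff hQ, not_lt,
        degree_eq_natDegree hQ.ne_zero, degree_eq_natDegree (ih (by omega)),
        natDegree_iterate_divByMonic hQ]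
      have h1 : (i + 1) * Q.natDegree ≤ f.natDegree :=
        (Nat.le_div_iff_mul_le hd).1 (by omega)
      rw [add_mul, one_mul] at h1
      exact_mod_cast (by omega : Q.natDegree ≤ f.natDegree - i * Q.natDegree)
  have hlt : f.natDegree < (D + 1) * Q.natDegree := by
    rw [mul_comm]; exact Nat.lt_mul_div_succ _ hd
  apply natDegree_eq_of_le_of_coeff_ne_zero
  · rw [natDegree_le_iff_coeff_eq_zero]
    intro N hN
    apply coeff_expPoly_eq_zero hQ hd
    exact hlt.trans_le (Nat.mul_le_mul_right _ hN)
  · rw [coeff_expPoly hQ hd, expCoeff, (modByMonic_eq_self_iff hQ).2]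
    · exact hne D le_rfl
    · apply degree_lt_degree
      rw [natDegree_iterate_divByMonic hQ]
      rw [add_mul, one_mul] at hlt
      omega

theorem natDegree_eval_lt (hd : 0 < Q.natDegree) {M : K[X][X]} {N : ℕ}
    (hM : ∀ i, (M.coeff i).natDegree < Q.natDegree) (hN : ∀ i, N < i → M.coeff i = 0) :
    (M.eval Q).natDegree < (N + 1) * Q.natDegree := by
  have hMN : M.natDegree < N + 1 := by
    rw [Nat.lt_succ_iff, natDegree_le_iff_coeff_eq_zero]
    exact hN
  rw [eval_eq_sum_range' hMN]
  refine lt_of_le_of_lt (natDegree_sum_le_of_forall_le (n := (N + 1) * Q.natDegree - 1) _ _ ?_) ?_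
  · intro i hi
    rw [Finset.mem_range] at hi
    have h1 := natDegree_mul_le (p := M.coeff i) (q := Q ^ i)
    have h2 := natDegree_pow_le (p := Q) (n := i)
    have h3 := hM i
    have h4 : (i + 1) * Q.natDegree ≤ (N + 1) * Q.natDegree := Nat.mul_le_mul_right _ hi
    rw [add_mul, one_mul] at h4
    omega
  · have : 0 < (N + 1) * Q.natDegree := by positivity
    omega

end ExpansionLemmas

theorem toE_le_toE {x y : WithTop ℝ} : toE x ≤ toE y ↔ x ≤ y := WithBot.coe_le_coe

theorem toE_lt_toE {x y : WithTop ℝ} : toE x < toE y ↔ x < y := WithBot.coe_lt_coe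

theorem toE_coe (x : ℝ) : toE (x : WithTop ℝ) = (x : EReal) := rfl

theorem exists_mem_eq_multiset_sup {α β : Type*} [LinearOrder β] [OrderBot β] (g : α → β)
    {s : Multiset α} (hs : s ≠ 0) : ∃ b ∈ s, (s.map g).sup = g b := by
  induction s using Multiset.induction_on with
  | empty => exact absurd rfl hs
  | cons a s ih =>
    rcases eq_or_ne s 0 with rfl | h
    · exact ⟨a, by simp, by simp⟩
    · obtain ⟨b, hb, he⟩ := ih h
      rw [Multiset.map_cons, Multiset.sup_cons, he]
      rcases le_total (g a) (g b) with hab | hab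
      · exact ⟨b, Multiset.mem_cons_of_mem hb, sup_eq_right.2 hab⟩
      · exact ⟨a, Multiset.mem_cons_self _ _, sup_eq_left.2 hab⟩

/-! ### Truncations at key polynomials as restricted Gauss valuations. -/

section Keys

variable {K E : Type*} [Field K] [Field E] [Algebra K E]

/-- The restriction to `K[X]` of a valuation on `E[X]`. -/
noncomputable def restrict (K : Type*) [Field K] [Algebra K E]
    (V : AddValuation E[X] (WithTop ℝ)) : AddValuation K[X] (WithTop ℝ) :=
  V.comap (mapRingHom (algebraMap K E))

theorem restrict_apply (V : AddValuation E[X] (WithTop ℝ)) (f : K[X]) :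
    restrict K V f = V (f.map (algebraMap K E)) := rfl

variable {V : AddValuation E[X] (WithTop ℝ)}

theorem le_eps {f : K[X]} {b : E} (hb : b ∈ f.aroots E) : toE (V (X - C b)) ≤ eps V f :=
  Multiset.le_sup (Multiset.mem_map_of_mem _ hb)

theorem eps_eq_bot {f : K[X]} (hf : f.natDegree = 0) : eps V f = ⊥ := by
  rw [eps, eq_C_of_natDegree_eq_zero hf, aroots_C]
  rfl

theorem eps_C_mul {c : K} (hc : c ≠ 0) (f : K[X]) : eps V (C c * f) = eps V f := by
  rw [eps, eps, aroots_C_mul _ hc]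

theorem eps_mul_le {f g : K[X]} {c : EReal} (hf : eps V f ≤ c) (hg : eps V g ≤ c) :
    eps V (f * g) ≤ c := by
  rcases eq_or_ne (f * g) 0 with h | h
  · rw [h, eps_eq_bot natDegree_zero]
    exact bot_le
  · rw [eps, aroots_mul h, Multiset.map_add, Multiset.sup_add]
    exact sup_le hf hg

theorem eps_pow_le {f : K[X]} {c : EReal} (hf : eps V f ≤ c) (k : ℕ) : eps V (f ^ k) ≤ c := by
  induction k with
  | zero => rw [pow_zero, eps_eq_bot natDegree_one]; exact bot_le
  | succ k ih => rw [pow_succ]; exact eps_mul_le ih hf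

/-- The real number `ε(P)`. -/
noncomputable def rad (V : AddValuation E[X] (WithTop ℝ)) (P : K[X]) : ℝ := (eps V P).toReal

/-- A root of `P` of maximal value. -/
noncomputable def center (V : AddValuation E[X] (WithTop ℝ)) (P : K[X]) : E :=
  Classical.epsilon fun a => aeval a P = 0 ∧ V (X - C a) = rad V P

/-- The valuation `ν_P` on `K[X]` attached to a key polynomial `P`. -/
noncomputable def truncVal (V : AddValuation E[X] (WithTop ℝ)) (P : K[X]) :
    AddValuation K[X] (WithTop ℝ) :=
  restrict K (gaussVal (rad V P) V (center V P))

/-- Key polynomials of finite value. -/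
structure IsFiniteKey (V : AddValuation E[X] (WithTop ℝ)) (P : K[X]) : Prop where
  key : IsKeyPolynomial V P
  ne_top : restrict K V P ≠ ⊤

namespace IsFiniteKey

variable {P P' : K[X]}

theorem monic (hP : IsFiniteKey V P) : P.Monic := hP.key.1

theorem natDegree_pos (hP : IsFiniteKey V P) : 0 < P.natDegree := hP.key.2.1

theorem eps_lt (hP : IsFiniteKey V P) {f : K[X]} (hf : f.natDegree < P.natDegree) :
    eps V f < eps V P := hP.key.2.2 f hf

theorem natDegree_modByMonic_lt (hP : IsFiniteKey V P) (f : K[X]) :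
    (f %ₘ P).natDegree < P.natDegree :=
  Polynomial.natDegree_modByMonic_lt _ hP.monic fun h => by simpa [h] using hP.natDegree_pos

theorem truncVal_ne_top {f : K[X]} (hf : f ≠ 0) : truncVal V P f ≠ ⊤ :=
  gaussVal_ne_top _ _ _ (Polynomial.map_ne_zero hf)

end IsFiniteKey

variable [IsAlgClosed E]

theorem aroots_ne_zero {f : K[X]} (hf : 0 < f.natDegree) : f.aroots E ≠ 0 := by
  rw [aroots_def, ← Multiset.card_pos, IsAlgClosed.card_roots_eq_natDegree, natDegree_map]
  exact hf

theorem exists_root_eps {f : K[X]} (hf : 0 < f.natDegree) :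
    ∃ b ∈ f.aroots E, eps V f = toE (V (X - C b)) :=
  exists_mem_eq_multiset_sup _ (aroots_ne_zero hf)

/-- Finiteness of ν(P) passes to the factor `X - a` for a root `a`, so ε(P) is a real number and can
serve as a radius. -/
theorem exists_center {P : K[X]} (hd : 0 < P.natDegree) (hP : restrict K V P ≠ ⊤) :
    ∃ a : E, aeval a P = 0 ∧ V (X - C a) = rad V P ∧ eps V P = (rad V P : EReal) := by
  obtain ⟨a, ha, he⟩ := exists_root_eps (V := V) hd
  have hroot := (mem_aroots.1 ha).2
  have hne : V (X - C a) ≠ ⊤ := by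
    have hr : (P.map (algebraMap K E)).IsRoot a := by
      rwa [IsRoot, eval_map_algebraMap]
    obtain ⟨g, hg⟩ := dvd_iff_isRoot.2 hr
    rw [restrict_apply, hg, AddValuation.map_mul] at hP
    exact (WithTop.add_ne_top.1 hP).1
  obtain ⟨δ, hδ⟩ := WithTop.ne_top_iff_exists.1 hne
  have hr : rad V P = δ := by
    rw [rad, he, ← hδ, toE_coe, EReal.toReal_coe]
  exact ⟨a, hroot, by rw [hr, hδ], by rw [he, ← hδ, hr, toE_coe]⟩

namespace IsFiniteKey

variable {P P' : K[X]}

theorem eps_eq (hP : IsFiniteKey V P) : eps V P = (rad V P : EReal) :=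
  (exists_center hP.natDegree_pos hP.ne_top).choose_spec.2.2

theorem center_spec (hP : IsFiniteKey V P) :
    aeval (center V P) P = 0 ∧ V (X - C (center V P)) = rad V P := by
  obtain ⟨a, h1, h2, -⟩ := exists_center hP.natDegree_pos hP.ne_top
  exact Classical.epsilon_spec (p := fun a => aeval a P = 0 ∧ V (X - C a) = rad V P) ⟨a, h1, h2⟩

theorem center_val (hP : IsFiniteKey V P) : V (X - C (center V P)) = rad V P := hP.center_spec.2

theorem le_center_val (hP : IsFiniteKey V P) : (rad V P : WithTop ℝ) ≤ V (X - C (center V P)) :=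
  hP.center_val.ge

theorem root_le (hP : IsFiniteKey V P) {f : K[X]} (hf : eps V f ≤ eps V P) :
    ∀ b ∈ (f.map (algebraMap K E)).roots, V (X - C b) ≤ rad V P := by
  intro b hb
  rw [← toE_le_toE, toE_coe, ← hP.eps_eq]
  exact (le_eps hb).trans hf

theorem truncVal_le (hP : IsFiniteKey V P) (f : K[X]) : truncVal V P f ≤ restrict K V f :=
  gaussVal_le hP.le_center_val _

theorem truncVal_eq (hP : IsFiniteKey V P) {f : K[X]} (hf : eps V f ≤ eps V P) :
    truncVal V P f = restrict K V f :=
  gaussVal_eq hP.le_center_val (hP.root_le hf)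

theorem truncVal_self (hP : IsFiniteKey V P) : truncVal V P P = restrict K V P :=
  hP.truncVal_eq le_rfl

theorem truncVal_of_natDegree_lt (hP : IsFiniteKey V P) {f : K[X]}
    (hf : f.natDegree < P.natDegree) : truncVal V P f = restrict K V f :=
  hP.truncVal_eq (hP.eps_lt hf).le

theorem truncVal_mono (hP : IsFiniteKey V P) (hP' : IsFiniteKey V P') (h : eps V P ≤ eps V P')
    (f : K[X]) : truncVal V P f ≤ truncVal V P' f := by
  refine gaussVal_mono hP.le_center_val hP'.le_center_val ?_ _
  rw [hP.eps_eq, hP'.eps_eq] at h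
  exact_mod_cast h

theorem map_center_of_eps_lt (hP : IsFiniteKey V P) {f : K[X]} (hf : eps V f < eps V P) :
    V (C (aeval (center V P) f)) = restrict K V f := by
  rw [restrict_apply, ← eval_map_algebraMap]
  refine map_eval_of_roots_lt fun b hb => ?_
  rw [hP.center_val, ← toE_lt_toE, toE_coe, ← hP.eps_eq]
  exact (le_eps hb).trans_lt hf

theorem aeval_center_modByMonic (hP : IsFiniteKey V P) (f : K[X]) :
    aeval (center V P) (f %ₘ P) = aeval (center V P) f := by
  conv_rhs => rw [← modByMonic_add_div f P]
  rw [_root_.map_add, _root_.map_mul, hP.center_spec.1, zero_mul, add_zero]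

/-- `f` and its remainder take the same value at the centre, a root of `P`, and both have all their
roots farther from `X` than the centre is, so evaluation there computes their valuations. -/
theorem map_modByMonic (hP : IsFiniteKey V P) {f : K[X]} (hf : eps V f < eps V P) :
    restrict K V (f %ₘ P) = restrict K V f := by
  rw [← hP.map_center_of_eps_lt (hP.eps_lt (hP.natDegree_modByMonic_lt f)),
    hP.aeval_center_modByMonic, hP.map_center_of_eps_lt hf]

/-- A root `b` of `f` with `V (X - b) > ε(P)` contributes a minimum that strictly increases with the
radius; the cofactor has finite value and cannot decrease. -/
theorem truncVal_lt_truncVal (hP : IsFiniteKey V P) (hP' : IsFiniteKey V P')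
    (h : eps V P < eps V P') {f : K[X]} (hf : eps V P < eps V f) :
    truncVal V P f < truncVal V P' f := by
  have hd : 0 < f.natDegree := by
    by_contra h0
    rw [eps_eq_bot (f := f) (by omega)] at hf
    exact not_lt_bot hf
  obtain ⟨b, hb, hbe⟩ := exists_root_eps (V := V) hd
  have hr : (f.map (algebraMap K E)).IsRoot b := by
    rw [IsRoot, eval_map_algebraMap]
    exact (mem_aroots.1 hb).2
  obtain ⟨g, hg⟩ := dvd_iff_isRoot.2 hr
  rw [hP.eps_eq, hP'.eps_eq] at h
  rw [hP.eps_eq, hbe, ← toE_coe, toE_lt_toE] at hf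
  have h' : rad V P < rad V P' := by exact_mod_cast h
  have hg0 : g ≠ 0 := by
    rintro rfl
    rw [mul_zero, Polynomial.map_eq_zero] at hg
    simp [hg] at hd
  change gaussVal _ V _ (f.map _) < gaussVal _ V _ (f.map _)
  rw [hg, AddValuation.map_mul, AddValuation.map_mul, gaussVal_X_sub_C_of_le hP.le_center_val,
    gaussVal_X_sub_C_of_le hP'.le_center_val]
  calc min (rad V P : WithTop ℝ) (V (X - C b)) + gaussVal (rad V P) V (center V P) g
      < min (rad V P' : WithTop ℝ) (V (X - C b)) + gaussVal (rad V P) V (center V P) g := by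
        refine WithTop.add_lt_add_right (gaussVal_ne_top _ _ _ hg0) ?_
        rw [min_eq_left hf.le]
        exact lt_min (by exact_mod_cast h') hf
    _ ≤ _ := by
        gcongr
        exact gaussVal_mono hP.le_center_val hP'.le_center_val h'.le g

/-- The Gauss value of `f` is at most that of its constant Taylor coefficient, `f` at the centre,
and the latter is the value of the remainder `f %ₘ P`. Subtracting the remainder and cancelling `P`
leads to the next coefficient. -/
theorem truncVal_le_coeff (hP : IsFiniteKey V P) (i : ℕ) (f : K[X]) :
    truncVal V P f ≤ restrict K V ((expPoly P f).coeff i * P ^ i) := by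
  rw [coeff_expPoly hP.monic hP.natDegree_pos]
  induction i generalizing f with
  | zero =>
    change truncVal V P f ≤ restrict K V ((f %ₘ P) * P ^ 0)
    rw [pow_zero, mul_one,
      ← hP.map_center_of_eps_lt (hP.eps_lt (hP.natDegree_modByMonic_lt f)),
      hP.aeval_center_modByMonic, ← eval_map_algebraMap]
    exact gaussVal_le_eval _ _ _ _
  | succ i ih =>
    have h0 : truncVal V P f ≤ truncVal V P (f %ₘ P) := by
      rw [hP.truncVal_of_natDegree_lt (hP.natDegree_modByMonic_lt f),
        ← hP.map_center_of_eps_lt (hP.eps_lt (hP.natDegree_modByMonic_lt f)),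
        hP.aeval_center_modByMonic, ← eval_map_algebraMap]
      exact gaussVal_le_eval _ _ _ _
    have h1 : truncVal V P f ≤ truncVal V P (f - f %ₘ P) := AddValuation.map_le_sub _ le_rfl h0
    have h2 : f - f %ₘ P = P * (f /ₘ P) := by
      rw [sub_eq_iff_eq_add']; exact (modByMonic_add_div f P).symm
    rw [h2, AddValuation.map_mul, hP.truncVal_self] at h1
    refine h1.trans ?_
    change _ ≤ restrict K V (expCoeff P (f /ₘ P) i * P ^ (i + 1))
    rw [pow_succ, ← mul_assoc, AddValuation.map_mul _ _ P, add_comm]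
    gcongr
    exact ih _

theorem truncVal_mul_pow (hP : IsFiniteKey V P) {c : K[X]} (hc : c.natDegree < P.natDegree)
    (i : ℕ) : truncVal V P (c * P ^ i) = restrict K V (c * P ^ i) := by
  rw [AddValuation.map_mul, AddValuation.map_pow, hP.truncVal_self,
    hP.truncVal_of_natDegree_lt hc, AddValuation.map_mul, AddValuation.map_pow]

theorem truncation_eq (hP : IsFiniteKey V P) (f : K[X]) :
    truncation (restrict K V) P f = truncVal V P f := by
  apply le_antisymm
  · conv_rhs => rw [← expPoly_eval hP.monic hP.natDegree_pos f, eval_eq_sum, Polynomial.sum]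
    refine AddValuation.map_le_sum _ fun i hi => ?_
    rw [hP.truncVal_mul_pow (natDegree_coeff_expPoly_lt hP.monic hP.natDegree_pos f i)]
    exact Finset.inf_le hi
  · exact Finset.le_inf fun i _ => hP.truncVal_le_coeff i f

/-- Reduction modulo `P` changes a polynomial whose roots lie outside the ball of a smaller key
polynomial of the same degree only by an error of larger value. -/
theorem add_rad_le_truncVal_sub_modByMonic (hP : IsFiniteKey V P) (hP' : IsFiniteKey V P')
    (hdeg : P.natDegree ≤ P'.natDegree) (h : eps V P' < eps V P) {f : K[X]}
    (hf : eps V f ≤ eps V P') :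
    restrict K V f + (rad V P : WithTop ℝ) ≤
      truncVal V P (f - f %ₘ P) + (rad V P' : WithTop ℝ) := by
  have hr : rad V P' ≤ rad V P := by
    rw [hP.eps_eq, hP'.eps_eq] at h
    exact_mod_cast h.le
  have ha : (rad V P' : WithTop ℝ) ≤ V (X - C (center V P)) := by
    rw [hP.center_val]
    exact_mod_cast hr
  -- An intermediate Gauss valuation: the centre of `P` with the radius of `P'`. It agrees with ν on
  -- `f` and on its remainder, and raising the radius to that of `P` gains at least the difference
  -- of radii on the factor `P`, which vanishes at the centre.
  set W := restrict K (gaussVal (rad V P') V (center V P))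
  have hWf : W f = restrict K V f := gaussVal_eq ha (hP'.root_le hf)
  have hWr : W (f %ₘ P) = restrict K V f := by
    rw [← hP.map_modByMonic (hf.trans_lt h)]
    exact gaussVal_eq ha
      (hP'.root_le (hP'.eps_lt ((hP.natDegree_modByMonic_lt f).trans_le hdeg)).le)
  have h2 : f - f %ₘ P = P * (f /ₘ P) := by
    rw [sub_eq_iff_eq_add']; exact (modByMonic_add_div f P).symm
  have h1 : restrict K V f ≤ W (f - f %ₘ P) := AddValuation.map_le_sub _ hWf.ge hWr.ge
  rw [h2, AddValuation.map_mul] at h1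
  rw [h2, AddValuation.map_mul, hP.truncVal_self]
  have h3 : W (f /ₘ P) ≤ truncVal V P (f /ₘ P) := gaussVal_mono ha hP.le_center_val hr _
  have h4 : W P + (rad V P : WithTop ℝ) ≤ restrict K V P + (rad V P' : WithTop ℝ) := by
    refine gaussVal_add_le (b := center V P) ha ?_ hP.le_center_val
    change (P.map (algebraMap K E)).eval (center V P) = 0
    rw [eval_map_algebraMap]
    exact hP.center_spec.1
  calc restrict K V f + (rad V P : WithTop ℝ) ≤ W P + W (f /ₘ P) + (rad V P : WithTop ℝ) := by
        gcongr
    _ = (W P + (rad V P : WithTop ℝ)) + W (f /ₘ P) := by abel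
    _ ≤ (restrict K V P + (rad V P' : WithTop ℝ)) + truncVal V P (f /ₘ P) := by gcongr
    _ = _ := by abel

end IsFiniteKey

end Keys

/-! ### Comparison of members of a bounded plateau. -/

section Plateau

variable {K E : Type*} [Field K] [Field E] [Algebra K E]
  {V : AddValuation E[X] (WithTop ℝ)} {n : ℕ}

/-- `Ψ_n` is a plateau on which `ν` is bounded by a real number. -/
structure IsBoundedPlateau (K : Type*) [Field K] [Algebra K E]
    (V : AddValuation E[X] (WithTop ℝ)) (n : ℕ) : Prop where
  plateau : IsPlateau (restrict K V) V n
  bdd : ∃ γ : ℝ, ∀ Q ∈ Psi K V n, restrict K V Q ≤ (γ : WithTop ℝ)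

/-- The real value of a polynomial of finite value. -/
noncomputable def val (V : AddValuation E[X] (WithTop ℝ)) (P : K[X]) : ℝ :=
  (restrict K V P).untopD 0

theorem coe_val_of_ne_top {P : K[X]} (hP : restrict K V P ≠ ⊤) :
    (val V P : WithTop ℝ) = restrict K V P := by
  obtain ⟨x, hx⟩ := WithTop.ne_top_iff_exists.1 hP
  rw [val, ← hx, WithTop.untopD_coe]

/-- The supremum of the real values on `Ψ_n`. -/
noncomputable def supVal (K : Type*) [Field K] [Algebra K E]
    (V : AddValuation E[X] (WithTop ℝ)) (n : ℕ) : ℝ :=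
  sSup (val V '' Psi K V n)

theorem natDegree_sub_lt_of_mem_Psi {P Q : K[X]} (hQ : Q ∈ Psi K V n) (hP : P ∈ Psi K V n) :
    (Q - P).natDegree < n := by
  have hn : 0 < n := hQ.2 ▸ hQ.1.2.1
  rcases eq_or_ne (Q - P) 0 with h0 | h0
  · rwa [h0, natDegree_zero]
  · have h1 : (Q - P).degree < Q.degree := by
      apply degree_sub_lt_left
      · rw [degree_eq_natDegree hQ.1.1.ne_zero, degree_eq_natDegree hP.1.1.ne_zero, hQ.2, hP.2]
      · exact hQ.1.1.ne_zero
      · rw [hQ.1.1.leadingCoeff, hP.1.1.leadingCoeff]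
    rw [← hQ.2]
    exact natDegree_lt_natDegree h0 h1

namespace IsBoundedPlateau

variable {P Q : K[X]}

theorem isFiniteKey (h : IsBoundedPlateau K V n) (hP : P ∈ Psi K V n) : IsFiniteKey V P := by
  obtain ⟨γ, hγ⟩ := h.bdd
  exact ⟨hP.1, ne_top_of_le_ne_top WithTop.coe_ne_top (hγ P hP)⟩

theorem coe_val (h : IsBoundedPlateau K V n) (hP : P ∈ Psi K V n) :
    (val V P : WithTop ℝ) = restrict K V P :=
  coe_val_of_ne_top (h.isFiniteKey hP).ne_top

theorem n_pos (h : IsBoundedPlateau K V n) : 0 < n := by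
  obtain ⟨P, hP⟩ := h.plateau.1
  exact hP.2 ▸ hP.1.2.1

theorem val_lt_iff (h : IsBoundedPlateau K V n) (hQ : Q ∈ Psi K V n) (hP : P ∈ Psi K V n) :
    val V Q < val V P ↔ restrict K V Q < restrict K V P := by
  rw [← h.coe_val hQ, ← h.coe_val hP, WithTop.coe_lt_coe]

theorem val_le_iff (h : IsBoundedPlateau K V n) (hQ : Q ∈ Psi K V n) (hP : P ∈ Psi K V n) :
    val V Q ≤ val V P ↔ restrict K V Q ≤ restrict K V P := by
  rw [← h.coe_val hQ, ← h.coe_val hP, WithTop.coe_le_coe]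

theorem map_mul_pow (h : IsBoundedPlateau K V n) (hP : P ∈ Psi K V n) (c : K[X]) (i : ℕ) :
    restrict K V (c * P ^ i) = restrict K V c + ((i * val V P : ℝ) : WithTop ℝ) := by
  rw [AddValuation.map_mul, AddValuation.map_pow, ← h.coe_val hP, ← WithTop.coe_nsmul,
    nsmul_eq_mul]

theorem exists_val_lt (h : IsBoundedPlateau K V n) (hP : P ∈ Psi K V n) :
    ∃ P' ∈ Psi K V n, val V P < val V P' := by
  by_contra! hc
  refine h.plateau.2 ⟨P, hP, fun P' hP' => ?_⟩
  exact (h.val_le_iff hP' hP).1 (hc P' hP')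

theorem bddAbove (h : IsBoundedPlateau K V n) : BddAbove (val V '' Psi K V n) := by
  obtain ⟨γ, hγ⟩ := h.bdd
  refine ⟨γ, ?_⟩
  rintro _ ⟨P, hP, rfl⟩
  have := hγ P hP
  rw [← h.coe_val hP] at this
  exact_mod_cast this

theorem val_lt_supVal (h : IsBoundedPlateau K V n) (hP : P ∈ Psi K V n) :
    val V P < supVal K V n := by
  obtain ⟨P', hP', hlt⟩ := h.exists_val_lt hP
  exact hlt.trans_le (le_csSup h.bddAbove ⟨P', hP', rfl⟩)

theorem exists_lt_val (h : IsBoundedPlateau K V n) {c : ℝ} (hc : c < supVal K V n) :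
    ∃ P ∈ Psi K V n, c < val V P := by
  obtain ⟨_, ⟨P, hP, rfl⟩, hlt⟩ := exists_lt_of_lt_csSup (h.plateau.1.image _) hc
  exact ⟨P, hP, hlt⟩

theorem limitValue_eq (h : IsBoundedPlateau K V n) :
    limitValue (restrict K V) V n = (supVal K V n : EReal) := by
  apply le_antisymm
  · refine iSup₂_le fun P hP => ?_
    rw [← h.coe_val hP, toE_coe]
    exact_mod_cast (h.val_lt_supVal hP).le
  · refine EReal.ge_of_forall_gt_iff_ge.1 fun c hc => ?_
    obtain ⟨P, hP, hlt⟩ := h.exists_lt_val (EReal.coe_lt_coe_iff.1 hc)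
    refine le_trans ?_ (le_iSup₂ (f := fun (Q : K[X]) (_ : Q ∈ Psi K V n) =>
      toE (restrict K V Q)) P hP)
    rw [← h.coe_val hP, toE_coe]
    exact_mod_cast hlt.le

theorem map_sub_eq (h : IsBoundedPlateau K V n) (hQ : Q ∈ Psi K V n) (hP : P ∈ Psi K V n)
    (hlt : val V Q < val V P) : restrict K V (Q - P) = val V Q := by
  rw [h.coe_val hQ]
  exact AddValuation.map_sub_eq_of_lt_left _ ((h.val_lt_iff hQ hP).1 hlt)

variable [IsAlgClosed E]

/-- Both polynomials are monic of degree `n`, so the `Q`-expansion of `P` is `X + (P - Q)`. -/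
theorem truncVal_eq_min (h : IsBoundedPlateau K V n) (hQ : Q ∈ Psi K V n) (hP : P ∈ Psi K V n) :
    truncVal V Q P = min (restrict K V Q) (restrict K V (P - Q)) := by
  have hd := natDegree_sub_lt_of_mem_Psi hP hQ
  have hQk := h.isFiniteKey hQ
  apply le_antisymm
  · have hM : expPoly Q P = X + C (P - Q) := by
      conv_lhs => rw [show P = (X + C (P - Q) : K[X][X]).eval Q by simp]
      refine expPoly_eval_eq hQ.1.1 hQ.1.2.1 fun i => ?_
      rw [hQ.2]
      rcases i with _ | _ | i
      · simpa using hd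
      · simpa using h.n_pos
      · rw [coeff_add, coeff_C_succ, coeff_X, if_neg (by omega), add_zero, natDegree_zero]
        exact h.n_pos
    have h0 := hQk.truncVal_le_coeff 0 P
    have h1 := hQk.truncVal_le_coeff 1 P
    rw [hM] at h0 h1
    simp only [coeff_add, coeff_X_zero, coeff_C_zero, zero_add, pow_zero, mul_one, coeff_X_one,
      coeff_C_succ, add_zero, one_mul, pow_one] at h0 h1
    exact le_min h1 h0
  · have := (truncVal V Q).map_add Q (P - Q)
    rwa [add_sub_cancel, hQk.truncVal_self, hQk.truncVal_of_natDegree_lt (hQ.2 ▸ hd)] at this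

/-- If ε(Q) < ε(P), then ν_Q(P) < ν(P), which the formula for ν_Q(P) excludes when ν(P) ≤ ν(Q). If
ε(P) ≤ ε(Q), then ν(P) = ν_Q(P) ≤ ν(Q). -/
theorem eps_lt_eps_iff (h : IsBoundedPlateau K V n) (hQ : Q ∈ Psi K V n) (hP : P ∈ Psi K V n) :
    eps V Q < eps V P ↔ val V Q < val V P := by
  rw [h.val_lt_iff hQ hP]
  have hmin := h.truncVal_eq_min hQ hP
  constructor
  · intro hlt
    have hlt' := (h.isFiniteKey hQ).truncVal_lt_truncVal (h.isFiniteKey hP) hlt hlt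
    rw [(h.isFiniteKey hP).truncVal_self, hmin] at hlt'
    by_contra hle
    rw [not_lt] at hle
    exact absurd hlt' (not_lt.2 (le_min hle (AddValuation.map_le_sub _ le_rfl hle)))
  · intro hlt
    by_contra hle
    rw [not_lt] at hle
    rw [(h.isFiniteKey hQ).truncVal_eq hle] at hmin
    exact absurd hlt (not_lt.2 (hmin.le.trans (min_le_left _ _)))

theorem eps_le_eps_iff (h : IsBoundedPlateau K V n) (hQ : Q ∈ Psi K V n) (hP : P ∈ Psi K V n) :
    eps V Q ≤ eps V P ↔ val V Q ≤ val V P := by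
  rw [← not_lt, ← not_lt, h.eps_lt_eps_iff hP hQ]

theorem rad_lt_rad (h : IsBoundedPlateau K V n) (hQ : Q ∈ Psi K V n) (hP : P ∈ Psi K V n)
    (hlt : val V Q < val V P) : rad V Q < rad V P := by
  have := (h.eps_lt_eps_iff hQ hP).2 hlt
  rw [(h.isFiniteKey hQ).eps_eq, (h.isFiniteKey hP).eps_eq] at this
  exact_mod_cast this

theorem rad_le_rad (h : IsBoundedPlateau K V n) (hQ : Q ∈ Psi K V n) (hP : P ∈ Psi K V n)
    (hle : val V Q ≤ val V P) : rad V Q ≤ rad V P := by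
  have := (h.eps_le_eps_iff hQ hP).2 hle
  rw [(h.isFiniteKey hQ).eps_eq, (h.isFiniteKey hP).eps_eq] at this
  exact_mod_cast this

theorem truncVal_mono (h : IsBoundedPlateau K V n) (hQ : Q ∈ Psi K V n) (hP : P ∈ Psi K V n)
    (hle : val V Q ≤ val V P) (f : K[X]) : truncVal V Q f ≤ truncVal V P f :=
  (h.isFiniteKey hQ).truncVal_mono (h.isFiniteKey hP) ((h.eps_le_eps_iff hQ hP).2 hle) f

theorem truncVal_mul_pow_of_le (h : IsBoundedPlateau K V n) (hQ : Q ∈ Psi K V n)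
    (hP : P ∈ Psi K V n) (hle : val V Q ≤ val V P) {c : K[X]} (hc : c.natDegree < n) (i : ℕ) :
    truncVal V Q (c * P ^ i) = restrict K V c + ((i * val V Q : ℝ) : WithTop ℝ) := by
  have hQP : truncVal V Q P = restrict K V Q := by
    rw [h.truncVal_eq_min hQ hP, min_eq_left]
    exact AddValuation.map_le_sub _ ((h.val_le_iff hQ hP).1 hle) le_rfl
  rw [AddValuation.map_mul, AddValuation.map_pow, hQP, ← h.coe_val hQ, ← WithTop.coe_nsmul,
    nsmul_eq_mul, (h.isFiniteKey hQ).truncVal_of_natDegree_lt (hQ.2 ▸ hc)]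

/-- The truncations of `f` grow at most linearly, with slope the degree of its expansions. -/
theorem truncVal_growth (h : IsBoundedPlateau K V n) (hQ : Q ∈ Psi K V n) (hP : P ∈ Psi K V n)
    (hle : val V Q ≤ val V P) {f : K[X]} {N : ℕ} (hf : f.natDegree < (N + 1) * n) :
    truncVal V P f + ((N * (val V Q - val V P) : ℝ) : WithTop ℝ) ≤ truncVal V Q f := by
  have hPm := hP.1.1
  have hPd := hP.1.2.1
  have hN : (expPoly P f).natDegree < N + 1 := by
    rw [Nat.lt_succ_iff, natDegree_le_iff_coeff_eq_zero]
    intro i hi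
    apply coeff_expPoly_eq_zero hPm hPd
    rw [hP.2]
    exact hf.trans_le (Nat.mul_le_mul_right _ hi)
  have hsum : f = ∑ i ∈ Finset.range (N + 1), (expPoly P f).coeff i * P ^ i := by
    conv_lhs => rw [← expPoly_eval hPm hPd f, eval_eq_sum_range' hN]
  conv_rhs => rw [hsum]
  refine AddValuation.map_le_sum _ fun i hi => ?_
  have hi' : (i : ℝ) ≤ N := by
    rw [Finset.mem_range] at hi
    exact_mod_cast Nat.lt_succ_iff.1 hi
  have h1 := (h.isFiniteKey hP).truncVal_le_coeff i f
  rw [h.map_mul_pow hP] at h1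
  rw [h.truncVal_mul_pow_of_le hQ hP hle (hP.2 ▸ natDegree_coeff_expPoly_lt hPm hPd f i)]
  -- The difference `val V Q - val V P` is not positive and `i ≤ N`, so the exponent `N` is the
  -- worst case.
  have h2 : (i : ℝ) * val V P + N * (val V Q - val V P) ≤ i * val V Q := by nlinarith
  calc _ ≤ restrict K V ((expPoly P f).coeff i) + ((i * val V P : ℝ) : WithTop ℝ) +
        ((N * (val V Q - val V P) : ℝ) : WithTop ℝ) := by gcongr
    _ = restrict K V ((expPoly P f).coeff i) +
        ((i * val V P + N * (val V Q - val V P) : ℝ) : WithTop ℝ) := by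
        rw [add_assoc, ← WithTop.coe_add]
    _ ≤ _ := by
        gcongr
        exact_mod_cast h2

/-- The terms of `M(u)` are products of polynomials of degree below `n`, so their roots do not
exceed ε(Q₀), whatever the degree of the product. The reduction estimate thus applies to each term
with `Q₀` as the smaller key polynomial. -/
theorem add_rad_sub_le_truncVal (h : IsBoundedPlateau K V n) {Q₀ : K[X]} (hQ₀ : Q₀ ∈ Psi K V n)
    (hP : P ∈ Psi K V n) (hlt : val V Q₀ < val V P) {M : K[X][X]} {u : K[X]}
    (hM : ∀ i, (M.coeff i).natDegree < n) (hu : u.natDegree < n) {m : WithTop ℝ}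
    (hm : ∀ k, m ≤ restrict K V (M.coeff k * u ^ k)) :
    m + ((rad V P - rad V Q₀ : ℝ) : WithTop ℝ) ≤
      truncVal V P (M.eval u - M.eval u %ₘ P) := by
  have hsum : M.eval u - M.eval u %ₘ P = ∑ i ∈ Finset.range (M.natDegree + 1),
      (M.coeff i * u ^ i - M.coeff i * u ^ i %ₘ P) := by
    have hmod : M.eval u %ₘ P =
        ∑ i ∈ Finset.range (M.natDegree + 1), (M.coeff i * u ^ i %ₘ P) := by
      rw [eval_eq_sum_range]
      exact _root_.map_sum (modByMonicHom P) _ _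
    rw [hmod, eval_eq_sum_range, Finset.sum_sub_distrib]
  rw [hsum]
  refine AddValuation.map_le_sum _ fun i _ => ?_
  have hkey := h.isFiniteKey hQ₀
  have he := (h.isFiniteKey hP).add_rad_le_truncVal_sub_modByMonic hkey (by rw [hP.2, hQ₀.2])
    ((h.eps_lt_eps_iff hQ₀ hP).2 hlt) (f := M.coeff i * u ^ i)
    (eps_mul_le (hkey.eps_lt (hQ₀.2 ▸ hM i)).le (eps_pow_le (hkey.eps_lt (hQ₀.2 ▸ hu)).le i))
  have h1 : m + (rad V P : WithTop ℝ) ≤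
      truncVal V P (M.coeff i * u ^ i - M.coeff i * u ^ i %ₘ P) + (rad V Q₀ : WithTop ℝ) :=
    (add_le_add (hm i) le_rfl).trans he
  generalize truncVal V P (M.coeff i * u ^ i - M.coeff i * u ^ i %ₘ P) = y at h1 ⊢
  induction y with
  | top => exact le_top
  | coe y =>
    induction m with
    | top => simp at h1
    | coe m => norm_cast at h1 ⊢; linarith

end IsBoundedPlateau

end Plateau

/-! ### Limit key polynomials and the limit of their truncations. -/

section Limit

variable {K E : Type*} [Field K] [Field E] [Algebra K E]
  {V : AddValuation E[X] (WithTop ℝ)} {n : ℕ}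

/-- The filter of members of `Ψ_n` of large value. -/
noncomputable def plateauFilter (K : Type*) [Field K] [Algebra K E]
    (V : AddValuation E[X] (WithTop ℝ)) (n : ℕ) : Filter K[X] :=
  ⨅ R ∈ Psi K V n, Filter.principal {P | P ∈ Psi K V n ∧ val V R ≤ val V P}

/-- The real value of a truncation. -/
noncomputable def truncReal (V : AddValuation E[X] (WithTop ℝ)) (f P : K[X]) : ℝ :=
  (truncVal V P f).untopD 0

/-- The supremum of the values of the truncations of `F` over `Ψ_n`. -/
noncomputable def supTrunc (V : AddValuation E[X] (WithTop ℝ)) (n : ℕ) (F : K[X]) : ℝ :=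
  sSup (truncReal V F '' Psi K V n)

theorem coe_truncReal {F : K[X]} (hF : F ≠ 0) (P : K[X]) :
    (truncReal V F P : WithTop ℝ) = truncVal V P F := by
  obtain ⟨x, hx⟩ := WithTop.ne_top_iff_exists.1
    (IsFiniteKey.truncVal_ne_top (V := V) (P := P) hF)
  rw [truncReal, ← hx, WithTop.untopD_coe]

theorem map_le_natCast_mul {R : Type*} [CommRing R] (W : AddValuation R (WithTop ℝ)) (k : ℕ)
    (x : R) : W x ≤ W (k * x) := by
  induction k with
  | zero => simp
  | succ k ih =>
    rw [Nat.cast_succ, add_mul, one_mul]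
    exact W.map_le_add ih le_rfl

theorem map_eq_or_lt_and_lt {R : Type*} [CommRing R] (W : AddValuation R (WithTop ℝ)) {x y : R}
    {b : WithTop ℝ} (h : b < W (x - y)) : W x = W y ∨ b < W x ∧ b < W y := by
  rcases lt_or_ge (W y) (W (x - y)) with h1 | h1
  · exact Or.inl (W.map_eq_of_lt_sub h1)
  · refine Or.inr ⟨?_, h.trans_le h1⟩
    have := W.map_lt_add h (h.trans_le h1)
    rwa [sub_add_cancel] at this

namespace IsBoundedPlateau

theorem eventually_iff (h : IsBoundedPlateau K V n) {p : K[X] → Prop} :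
    (∀ᶠ P in plateauFilter K V n, p P) ↔
      ∃ R ∈ Psi K V n, ∀ P ∈ Psi K V n, val V R ≤ val V P → p P := by
  have hb := Filter.hasBasis_biInf_principal (S := Psi K V n)
    (s := fun R => {P | P ∈ Psi K V n ∧ val V R ≤ val V P}) ?_ h.plateau.1
  · rw [plateauFilter, hb.eventually_iff]
    exact ⟨fun ⟨R, hR, hp⟩ => ⟨R, hR, fun P hP hle => hp ⟨hP, hle⟩⟩,
      fun ⟨R, hR, hp⟩ => ⟨R, hR, fun P hP => hp P hP.1 hP.2⟩⟩
  · intro R hR R' hR'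
    rcases le_total (val V R) (val V R') with hle | hle
    · exact ⟨R', hR', fun P hP => ⟨hP.1, hle.trans hP.2⟩, fun P hP => hP⟩
    · exact ⟨R, hR, fun P hP => hP, fun P hP => ⟨hP.1, hle.trans hP.2⟩⟩

theorem eventually_mem (h : IsBoundedPlateau K V n) :
    ∀ᶠ P in plateauFilter K V n, P ∈ Psi K V n := by
  obtain ⟨R, hR⟩ := h.plateau.1
  exact h.eventually_iff.2 ⟨R, hR, fun P hP _ => hP⟩

theorem eventually_lt (h : IsBoundedPlateau K V n) {Q : K[X]} (hQ : Q ∈ Psi K V n) :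
    ∀ᶠ P in plateauFilter K V n, val V Q < val V P := by
  obtain ⟨R, hR, hlt⟩ := h.exists_val_lt hQ
  exact h.eventually_iff.2 ⟨R, hR, fun P _ hle => hlt.trans_le hle⟩

theorem exists_of_eventually (h : IsBoundedPlateau K V n) {p : K[X] → Prop}
    (hp : ∀ᶠ P in plateauFilter K V n, p P) : ∃ P ∈ Psi K V n, p P := by
  obtain ⟨R, hR, hp⟩ := h.eventually_iff.1 hp
  exact ⟨R, hR, hp R hR le_rfl⟩

theorem one_le_degree_div (h : IsBoundedPlateau K V n) {F : K[X]}
    (hF : IsKeyPolynomialFor V n F) : 1 ≤ F.natDegree / n :=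
  (Nat.one_le_div_iff h.n_pos).2 hF.2.1.le

theorem expDegree_eq {F : K[X]} (hF : IsKeyPolynomialFor V n F)
    {P : K[X]} (hP : P ∈ Psi K V n) : expDegree P F = F.natDegree / n := by
  rw [LimitKey.expDegree_eq hP.1.1 hP.1.2.1 hF.1.1.ne_zero, hP.2]

variable {F H P Q : K[X]}

/-- A counterexample of least degree, made monic, would itself be a key polynomial. Its degree could
not be below `n` (compare with a member of Ψ_n), nor `n` (it would bound itself), nor larger
(minimality of deg F). -/
theorem exists_eps_le (h : IsBoundedPlateau K V n) (hF : IsKeyPolynomialFor V n F)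
    {f : K[X]} (hf : f.natDegree < F.natDegree) : ∃ Q ∈ Psi K V n, eps V f ≤ eps V Q := by
  induction hd : f.natDegree using Nat.strong_induction_on generalizing f with
  | _ d ih =>
    by_contra! hc
    obtain ⟨R, hR⟩ := h.plateau.1
    have hf0 : f ≠ 0 := by
      rintro rfl
      have := hc R hR
      rw [eps_eq_bot natDegree_zero] at this
      exact not_lt_bot this
    set g := C f.leadingCoeff⁻¹ * f with hg
    have hlc : f.leadingCoeff⁻¹ ≠ 0 := inv_ne_zero (leadingCoeff_ne_zero.2 hf0)
    have hgd : g.natDegree = f.natDegree := natDegree_C_mul hlc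
    have hge : eps V g = eps V f := eps_C_mul hlc f
    have hgm : g.Monic := by
      rw [Monic, hg, leadingCoeff_mul, leadingCoeff_C]
      exact inv_mul_cancel₀ (leadingCoeff_ne_zero.2 hf0)
    have hkey : IsKeyPolynomial V g := by
      refine ⟨hgm, ?_, fun k hk => ?_⟩
      · by_contra h0
        have := hc R hR
        rw [eps_eq_bot (f := f) (by omega)] at this
        exact not_lt_bot this
      · rw [hgd] at hk
        obtain ⟨Q, hQ, hle⟩ := ih k.natDegree (hd ▸ hk) (hk.trans hf) rfl
        rw [hge]
        exact hle.trans_lt (hc Q hQ)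
    rcases lt_trichotomy g.natDegree n with hlt | heq | hgt
    · have h1 := hR.1.2.2 g (hR.2 ▸ hlt)
      rw [hge] at h1
      exact lt_asymm h1 (hc R hR)
    · have h1 := hc g ⟨hkey, heq⟩
      rw [hge] at h1
      exact lt_irrefl _ h1
    · have h1 := hF.2.2 g hkey hgt
      omega

/-- Any polynomial of smaller degree is dominated by some member of Ψ_n, so a candidate need only be
compared with Ψ_n. -/
theorem isKeyPolynomialFor_of_eps_lt (h : IsBoundedPlateau K V n) (hF : IsKeyPolynomialFor V n F)
    {G : K[X]} (hG : G.Monic) (hd : G.natDegree = F.natDegree)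
    (he : ∀ Q ∈ Psi K V n, eps V Q < eps V G) : IsKeyPolynomialFor V n G := by
  refine ⟨⟨hG, hd ▸ hF.1.2.1, fun f hf => ?_⟩, hd ▸ hF.2.1, hd ▸ hF.2.2⟩
  obtain ⟨Q, hQ, hle⟩ := h.exists_eps_le hF (hd ▸ hf)
  exact hle.trans_lt (he Q hQ)

theorem eps_lt_of_mem (hF : IsKeyPolynomialFor V n F) (hQ : Q ∈ Psi K V n) :
    eps V Q < eps V F :=
  hF.1.2.2 Q (hQ.2 ▸ hF.2.1)

theorem natDegree_eq_of_isKeyPolynomialFor (hF : IsKeyPolynomialFor V n F)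
    (hH : IsKeyPolynomialFor V n H) : F.natDegree = H.natDegree :=
  le_antisymm (hF.2.2 H hH.1 hH.2.1) (hH.2.2 F hF.1 hF.2.1)

theorem natDegree_sub_lt (hF : IsKeyPolynomialFor V n F) (hH : IsKeyPolynomialFor V n H) :
    (F - H).natDegree < F.natDegree :=
  natDegree_sub_lt_of_mem_Psi (V := V) ⟨hF.1, rfl⟩
    ⟨hH.1, natDegree_eq_of_isKeyPolynomialFor hH hF⟩

variable [IsAlgClosed E]

theorem eventually_eps_lt (h : IsBoundedPlateau K V n) (hF : IsKeyPolynomialFor V n F)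
    {f : K[X]} (hf : f.natDegree < F.natDegree) :
    ∀ᶠ P in plateauFilter K V n, eps V f < eps V P := by
  obtain ⟨Q, hQ, hle⟩ := h.exists_eps_le hF hf
  filter_upwards [h.eventually_lt hQ, h.eventually_mem] with P hP hm
  exact hle.trans_lt ((h.eps_lt_eps_iff hQ hm).2 hP)

theorem truncReal_lt (h : IsBoundedPlateau K V n) (hF : IsKeyPolynomialFor V n F)
    (hQ : Q ∈ Psi K V n) (hP : P ∈ Psi K V n) (hlt : val V Q < val V P) :
    truncReal V F Q < truncReal V F P := by
  have := (h.isFiniteKey hQ).truncVal_lt_truncVal (h.isFiniteKey hP)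
    ((h.eps_lt_eps_iff hQ hP).2 hlt) (eps_lt_of_mem hF hQ)
  rw [← coe_truncReal hF.1.1.ne_zero, ← coe_truncReal hF.1.1.ne_zero] at this
  exact_mod_cast this

theorem truncReal_mono (h : IsBoundedPlateau K V n) (hF : F ≠ 0)
    (hQ : Q ∈ Psi K V n) (hP : P ∈ Psi K V n) (hle : val V Q ≤ val V P) :
    truncReal V F Q ≤ truncReal V F P := by
  have := h.truncVal_mono hQ hP hle F
  rw [← coe_truncReal hF, ← coe_truncReal hF] at this
  exact_mod_cast this

theorem truncReal_growth (h : IsBoundedPlateau K V n) (hF : F ≠ 0) (hQ : Q ∈ Psi K V n)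
    (hP : P ∈ Psi K V n) (hle : val V Q ≤ val V P) :
    truncReal V F P ≤ truncReal V F Q + (F.natDegree / n : ℕ) * (val V P - val V Q) := by
  have := h.truncVal_growth hQ hP hle (f := F) (N := F.natDegree / n)
    (by rw [mul_comm]; exact Nat.lt_mul_div_succ _ h.n_pos)
  rw [← coe_truncReal hF, ← coe_truncReal hF, ← WithTop.coe_add, WithTop.coe_le_coe] at this
  linarith

theorem truncReal_le (h : IsBoundedPlateau K V n) (hF : F ≠ 0) (hQ : Q ∈ Psi K V n)
    (hP : P ∈ Psi K V n) :
    truncReal V F P ≤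
      truncReal V F Q + (F.natDegree / n : ℕ) * (supVal K V n - val V Q) := by
  have h0 : (0 : ℝ) ≤ (F.natDegree / n : ℕ) := Nat.cast_nonneg _
  rcases le_total (val V Q) (val V P) with hle | hle
  · refine (h.truncReal_growth hF hQ hP hle).trans ?_
    have := (h.val_lt_supVal hP).le
    gcongr
  · have h1 := h.truncReal_mono hF hP hQ hle
    have h2 := (h.val_lt_supVal hQ).le
    nlinarith

/-- Bounds the growth of the truncations of `F` still to come after `Q`; the inequality defining `Q`
is designed to beat this amount. -/
theorem supTrunc_le (h : IsBoundedPlateau K V n) (hF : F ≠ 0) (hQ : Q ∈ Psi K V n) :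
    supTrunc V n F ≤ truncReal V F Q + (F.natDegree / n : ℕ) * (supVal K V n - val V Q) := by
  refine csSup_le (h.plateau.1.image _) ?_
  rintro _ ⟨P, hP, rfl⟩
  exact h.truncReal_le hF hQ hP

theorem bddAbove_truncReal (h : IsBoundedPlateau K V n) (hF : F ≠ 0) :
    BddAbove (truncReal V F '' Psi K V n) := by
  obtain ⟨Q, hQ⟩ := h.plateau.1
  refine ⟨truncReal V F Q + (F.natDegree / n : ℕ) * (supVal K V n - val V Q), ?_⟩
  rintro _ ⟨P, hP, rfl⟩
  exact h.truncReal_le hF hQ hP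

theorem truncReal_lt_supTrunc (h : IsBoundedPlateau K V n) (hF : IsKeyPolynomialFor V n F)
    (hP : P ∈ Psi K V n) : truncReal V F P < supTrunc V n F := by
  obtain ⟨P', hP', hlt⟩ := h.exists_val_lt hP
  exact (h.truncReal_lt hF hP hP' hlt).trans_le
    (le_csSup (h.bddAbove_truncReal hF.1.1.ne_zero) ⟨P', hP', rfl⟩)

theorem limitTrunc_eq (h : IsBoundedPlateau K V n) (hF : F ≠ 0) :
    limitTrunc (restrict K V) V n F = (supTrunc V n F : EReal) := by
  have hb := h.bddAbove_truncReal hF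
  apply le_antisymm
  · refine iSup₂_le fun P hP => ?_
    rw [(h.isFiniteKey hP).truncation_eq, ← coe_truncReal hF, toE_coe]
    exact_mod_cast le_csSup hb ⟨P, hP, rfl⟩
  · refine EReal.ge_of_forall_gt_iff_ge.1 fun c hc => ?_
    obtain ⟨_, ⟨P, hP, rfl⟩, hlt⟩ :=
      exists_lt_of_lt_csSup (h.plateau.1.image _) (EReal.coe_lt_coe_iff.1 hc)
    refine le_trans ?_ (le_iSup₂ (f := fun (Q : K[X]) (_ : Q ∈ Psi K V n) =>
      toE (truncation (restrict K V) Q F)) P hP)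
    rw [(h.isFiniteKey hP).truncation_eq, ← coe_truncReal hF, toE_coe]
    exact_mod_cast hlt.le

theorem truncVal_lt_map (h : IsBoundedPlateau K V n) (hF : IsKeyPolynomialFor V n F)
    (hP : P ∈ Psi K V n) : truncVal V P F < restrict K V F := by
  obtain ⟨P', hP', hlt⟩ := h.exists_val_lt hP
  exact ((h.isFiniteKey hP).truncVal_lt_truncVal (h.isFiniteKey hP')
    ((h.eps_lt_eps_iff hP hP').2 hlt) (eps_lt_of_mem hF hP)).trans_le
      ((h.isFiniteKey hP').truncVal_le F)

theorem supTrunc_le_map (h : IsBoundedPlateau K V n) (hF : IsKeyPolynomialFor V n F) :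
    (supTrunc V n F : WithTop ℝ) ≤ restrict K V F := by
  have hlt := fun P hP => (h.truncVal_lt_map hF (P := P) hP).le
  simp only [← coe_truncReal hF.1.1.ne_zero] at hlt
  generalize restrict K V F = y at hlt ⊢
  induction y with
  | top => exact le_top
  | coe y =>
    rw [WithTop.coe_le_coe]
    refine csSup_le (h.plateau.1.image _) ?_
    rintro _ ⟨P, hP, rfl⟩
    exact WithTop.coe_le_coe.1 (hlt P hP)

/-- If ν_P(F) < ν_P(H), then ν_P(F - H) = ν_P(F). But deg (F - H) < deg F, so far out ν_P(F - H) =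
ν(F - H) ≥ min (ν F) (ν H), and both ν(F) and ν(H) exceed ν_P(F). -/
theorem eventually_truncVal_eq (h : IsBoundedPlateau K V n) (hF : IsKeyPolynomialFor V n F)
    (hH : IsKeyPolynomialFor V n H) :
    ∀ᶠ P in plateauFilter K V n, truncVal V P F = truncVal V P H := by
  have hlt : ∀ {F H : K[X]}, IsKeyPolynomialFor V n F → IsKeyPolynomialFor V n H →
      ∀ᶠ P in plateauFilter K V n, ¬ truncVal V P F < truncVal V P H := by
    intro F H hF hH
    filter_upwards [h.eventually_eps_lt hF (natDegree_sub_lt hF hH), h.eventually_mem]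
      with P he hP hlt
    have h1 := (truncVal V P).map_sub_eq_of_lt_left hlt
    rw [(h.isFiniteKey hP).truncVal_eq he.le] at h1
    have h2 := (restrict K V).map_sub F H
    rw [h1] at h2
    exact absurd h2 (not_le.2 (lt_min (h.truncVal_lt_map hF hP)
      (hlt.trans (h.truncVal_lt_map hH hP))))
  filter_upwards [hlt hF hH, hlt hH hF] with P h1 h2
  exact le_antisymm (not_lt.1 h2) (not_lt.1 h1)

theorem supTrunc_eq (h : IsBoundedPlateau K V n) (hF : IsKeyPolynomialFor V n F)
    (hH : IsKeyPolynomialFor V n H) : supTrunc V n F = supTrunc V n H := by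
  have hle : ∀ {F H : K[X]}, IsKeyPolynomialFor V n F → IsKeyPolynomialFor V n H →
      supTrunc V n F ≤ supTrunc V n H := by
    intro F H hF hH
    refine csSup_le (h.plateau.1.image _) ?_
    rintro _ ⟨P, hP, rfl⟩
    obtain ⟨P', hP', heq, hlt⟩ :=
      h.exists_of_eventually ((h.eventually_truncVal_eq hF hH).and (h.eventually_lt hP))
    refine (h.truncReal_mono hF.1.1.ne_zero hP hP' hlt.le).trans ?_
    rw [truncReal, heq]
    exact (h.truncReal_lt_supTrunc hH hP').le
  exact le_antisymm (hle hF hH) (hle hH hF)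

theorem supTrunc_le_map_sub (h : IsBoundedPlateau K V n) (hF : IsKeyPolynomialFor V n F)
    (hH : IsKeyPolynomialFor V n H) : (supTrunc V n F : WithTop ℝ) ≤ restrict K V (F - H) :=
  AddValuation.map_le_sub _ (h.supTrunc_le_map hF) (h.supTrunc_eq hF hH ▸ h.supTrunc_le_map hH)

end IsBoundedPlateau

end Limit

/-! ### Approximating the coefficients of `F` by Hasse derivatives. -/

section Base

variable {K E : Type*} [Field K] [Field E] [Algebra K E]
  {V : AddValuation E[X] (WithTop ℝ)} {n : ℕ} {F Q₀ Q P : K[X]}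

theorem natDegree_coeff_hasseDeriv_lt (hP : P ∈ Psi K V n) (f : K[X]) (i k : ℕ) :
    ((hasseDeriv i (expPoly P f)).coeff k).natDegree < n := by
  rw [hasseDeriv_coeff]
  have := natDegree_coeff_expPoly_lt hP.1.1 hP.1.2.1 f (k + i)
  rw [hP.2] at this
  refine lt_of_le_of_lt ?_ this
  rw [← nsmul_eq_mul]
  exact natDegree_smul_le _ _

variable [IsAlgClosed E]

namespace IsBoundedPlateau

theorem isBase_iff (h : IsBoundedPlateau K V n) (hF : IsKeyPolynomialFor V n F) :
    IsBase (restrict K V) V n F Q₀ Q ↔ Q₀ ∈ Psi K V n ∧ Q ∈ Psi K V n ∧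
      (F.natDegree / n : ℕ) * (supVal K V n - val V Q) < rad V Q - rad V Q₀ := by
  rw [IsBase]
  refine and_congr_right fun hQ₀ => and_congr_right fun hQ => ?_
  rw [(h.isFiniteKey hQ₀).eps_eq, (h.isFiniteKey hQ).eps_eq, h.limitValue_eq, ← h.coe_val hQ,
    toE_coe, expDegree_eq hF hQ, ← EReal.coe_natCast, ← EReal.coe_sub, ← EReal.coe_sub,
    ← EReal.coe_mul, gt_iff_lt, EReal.coe_lt_coe_iff]

theorem val_lt_of_isBase (h : IsBoundedPlateau K V n) (hF : IsKeyPolynomialFor V n F)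
    (hb : IsBase (restrict K V) V n F Q₀ Q) : val V Q₀ < val V Q := by
  obtain ⟨hQ₀, hQ, hbase⟩ := (h.isBase_iff hF).1 hb
  by_contra hle
  have h0 : (0 : ℝ) ≤ (F.natDegree / n : ℕ) := Nat.cast_nonneg _
  have h1 := h.val_lt_supVal hQ
  have h2 := h.rad_le_rad hQ hQ₀ (not_lt.1 hle)
  nlinarith

/-- Any `R` beyond `Q₀` provides a fixed gap ε(R) - ε(Q₀) > 0. It then suffices to take `Q` beyond
`R` so close to the supremum that D(B - ν(Q)) is below this gap. -/
theorem exists_isBase (h : IsBoundedPlateau K V n) (hF : IsKeyPolynomialFor V n F)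
    (hQ₀ : Q₀ ∈ Psi K V n) : ∃ Q, IsBase (restrict K V) V n F Q₀ Q := by
  obtain ⟨R, hR, hlt⟩ := h.exists_val_lt hQ₀
  have hr := h.rad_lt_rad hQ₀ hR hlt
  have hD : (0 : ℝ) < (F.natDegree / n : ℕ) := by
    exact_mod_cast h.one_le_degree_div hF
  have hB := h.val_lt_supVal hR
  obtain ⟨Q, hQ, hc⟩ := h.exists_lt_val (c := max (val V R)
    (supVal K V n - (rad V R - rad V Q₀) / (F.natDegree / n : ℕ)))
    (max_lt hB (sub_lt_self _ (div_pos (sub_pos.2 hr) hD)))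
  rw [max_lt_iff] at hc
  refine ⟨Q, (h.isBase_iff hF).2 ⟨hQ₀, hQ, ?_⟩⟩
  have h1 := h.rad_le_rad hR hQ hc.1.le
  have h2 : supVal K V n - val V Q < (rad V R - rad V Q₀) / (F.natDegree / n : ℕ) := by
    linarith [hc.2]
  rw [lt_div_iff₀ hD] at h2
  linarith

/-- The values `β_i` are attained by `∂_i L (Q - P)` for `P` of large value. -/
theorem eventually_beta_eq (h : IsBoundedPlateau K V n) (hF : IsKeyPolynomialFor V n F)
    (hb : IsBase (restrict K V) V n F Q₀ Q) {i : ℕ} (hi : 1 ≤ i) :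
    ∀ᶠ P in plateauFilter K V n,
      beta (restrict K V) F Q i =
        restrict K V ((hasseDeriv i (expPoly Q F)).eval (Q - P)) := by
  obtain ⟨hQ₀, hQ, hbase⟩ := (h.isBase_iff hF).1 hb
  set M := hasseDeriv i (expPoly Q F) with hM
  set f := M.eval Q with hf
  have hMd : ∀ k, (M.coeff k).natDegree < n := natDegree_coeff_hasseDeriv_lt hQ F i
  have hexp : expPoly Q f = M := expPoly_eval_eq hQ.1.1 hQ.1.2.1 fun k => hQ.2 ▸ hMd k
  have hbeta : beta (restrict K V) F Q i = restrict K V f := rfl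
  rw [hbeta]
  rcases eq_or_ne f 0 with hf0 | hf0
  · have hM0 : M = 0 := by
      rw [← hexp, hf0, expPoly_of_natDegree_lt hQ.1.1 (by simpa using hQ.1.2.1), C_0]
    refine Filter.Eventually.of_forall fun P => ?_
    rw [hf0, hM0, eval_zero]
  · set D := F.natDegree / n with hD
    have hD1 : 1 ≤ D := h.one_le_degree_div hF
    -- As `i ≥ 1`, the derivative has degree at most `D - 1` in the outer variable, so `f` has
    -- degree below `D * n ≤ deg F`.
    have hfd : f.natDegree < F.natDegree := by
      have h1 : f.natDegree < (D - 1 + 1) * Q.natDegree := by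
        refine natDegree_eval_lt hQ.1.2.1 (fun k => hQ.2 ▸ hMd k) fun k hk => ?_
        rw [hM, hasseDeriv_coeff, coeff_eq_zero_of_natDegree_lt, mul_zero]
        have := expDegree_eq hF hQ
        rw [expDegree] at this
        omega
      rw [Nat.sub_add_cancel hD1, hQ.2] at h1
      exact h1.trans_le (Nat.div_mul_le_self _ _)
    have hvQ₀Q := h.val_lt_of_isBase hF hb
    filter_upwards [h.eventually_eps_lt hF hfd, h.eventually_lt hQ, h.eventually_mem]
      with P heps hlt hP
    have hPk := h.isFiniteKey hP
    set u := Q - P with hu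
    -- Since ν(P) > ν(Q), also ν(u) = ν(Q), and the terms of `M(u)` obey the same bound as those of
    -- `M(Q)`.
    have hm : ∀ k, truncVal V Q f ≤ restrict K V (M.coeff k * u ^ k) := by
      intro k
      have := (h.isFiniteKey hQ).truncVal_le_coeff k f
      rwa [hexp, AddValuation.map_mul, AddValuation.map_pow, ← h.coe_val hQ,
        ← h.map_sub_eq hQ hP hlt, ← AddValuation.map_pow, ← AddValuation.map_mul] at this
    have herr := (h.add_rad_sub_le_truncVal hQ₀ hP (hvQ₀Q.trans hlt) hMd
      (natDegree_sub_lt_of_mem_Psi hQ hP) hm).trans (hPk.truncVal_le _)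
    have hmod : M.eval u %ₘ P = f %ₘ P := by
      have hdvd : P ∣ f - M.eval u := by
        have := sub_dvd_eval_sub Q u M
        rwa [hu, sub_sub_cancel] at this
      have := (modByMonic_eq_zero_iff_dvd hP.1.1).2 hdvd
      rw [sub_modByMonic, sub_eq_zero] at this
      exact this.symm
    have hgr := h.truncVal_growth hQ hP hlt.le (f := f) (N := D)
      (hfd.trans (by rw [mul_comm]; exact Nat.lt_mul_div_succ _ h.n_pos))
    rw [hPk.truncVal_eq heps.le] at hgr
    have hfin : restrict K V f ≠ ⊤ := by
      rw [← hPk.truncVal_eq heps.le]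
      exact IsFiniteKey.truncVal_ne_top hf0
    have hrad := h.rad_le_rad hQ hP hlt.le
    -- ν(f) = ν_P(f) ≤ ν_Q(f) + D(ν(P) - ν(Q)) < ν_Q(f) + ε(P) - ε(Q₀), and the last quantity bounds
    -- the reduction error from below.
    have hlt' : restrict K V f < restrict K V (M.eval u - M.eval u %ₘ P) := by
      rw [← coe_val_of_ne_top hfin, ← coe_truncReal hf0, ← WithTop.coe_add,
        WithTop.coe_le_coe] at hgr
      rw [← coe_truncReal hf0, ← WithTop.coe_add] at herr
      rw [← coe_val_of_ne_top hfin]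
      refine lt_of_lt_of_le (WithTop.coe_lt_coe.2 ?_) herr
      have h0 : (0 : ℝ) ≤ (D : ℕ) := Nat.cast_nonneg _
      have := h.val_lt_supVal hP
      nlinarith
    have hres : restrict K V (M.eval u %ₘ P) = restrict K V f := by
      rw [hmod, hPk.map_modByMonic heps]
    rw [← hres] at hlt'
    rw [(restrict K V).map_eq_of_lt_sub hlt', hres]

/-- The coefficients of the `P`-expansion of `F` are approximated by `∂_i L (Q - P)`. -/
theorem supTrunc_lt_map_sub (h : IsBoundedPlateau K V n) (hF : IsKeyPolynomialFor V n F)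
    (hb : IsBase (restrict K V) V n F Q₀ Q) (hP : P ∈ Psi K V n) (hlt : val V Q < val V P)
    {i : ℕ} (hi : i ≤ F.natDegree / n) :
    (supTrunc V n F : WithTop ℝ) < restrict K V ((expPoly P F).coeff i * P ^ i -
      (hasseDeriv i (expPoly Q F)).eval (Q - P) * P ^ i) := by
  obtain ⟨hQ₀, hQ, hbase⟩ := (h.isBase_iff hF).1 hb
  set D := F.natDegree / n with hD
  set L := expPoly Q F with hL
  set u := Q - P with hu
  have hPk := h.isFiniteKey hP
  have hF0 : F ≠ 0 := hF.1.1.ne_zero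
  have hvQ₀Q := h.val_lt_of_isBase hF hb
  have hrad := h.rad_le_rad hQ hP hlt.le
  set err : ℕ → K[X] := fun j => (hasseDeriv j L).eval u - (hasseDeriv j L).eval u %ₘ P with herr
  have herrlt : ∀ j, (supTrunc V n F : WithTop ℝ) < truncVal V P (err j * P ^ j) := by
    intro j
    -- Differentiation lowers exponents by `j`, whence the loss of jν(Q), and its binomial factors
    -- cannot lower values. The later factor `P ^ j` makes up for this loss.
    have hm : ∀ k, ((truncReal V F Q - j * val V Q : ℝ) : WithTop ℝ) ≤
        restrict K V ((hasseDeriv j L).coeff k * u ^ k) := by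
      intro k
      have h1 := (h.isFiniteKey hQ).truncVal_le_coeff (k + j) F
      rw [h.map_mul_pow hQ, ← hL, ← coe_truncReal hF0] at h1
      have h2 := map_le_natCast_mul (restrict K V) ((k + j).choose j) (L.coeff (k + j))
      rw [AddValuation.map_mul, AddValuation.map_pow, h.map_sub_eq hQ hP hlt, hasseDeriv_coeff,
        ← WithTop.coe_nsmul, nsmul_eq_mul]
      refine le_trans ?_ (add_le_add h2 le_rfl)
      generalize restrict K V (L.coeff (k + j)) = y at h1 ⊢
      induction y with
      | top => simp
      | coe y =>
        rw [← WithTop.coe_add, WithTop.coe_le_coe] at h1 ⊢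
        push_cast at h1
        linarith
    have h3 := h.add_rad_sub_le_truncVal hQ₀ hP (hvQ₀Q.trans hlt)
      (natDegree_coeff_hasseDeriv_lt hQ F j) (natDegree_sub_lt_of_mem_Psi hQ hP) hm
    rw [AddValuation.map_mul, AddValuation.map_pow, hPk.truncVal_self, ← h.coe_val hP,
      ← WithTop.coe_nsmul, nsmul_eq_mul]
    refine lt_of_lt_of_le ?_ (add_le_add h3 le_rfl)
    rw [← WithTop.coe_add, ← WithTop.coe_add, WithTop.coe_lt_coe]
    have h4 := h.supTrunc_le hF0 hQ
    have h5 : (j : ℝ) * val V Q ≤ j * val V P := by gcongr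
    linarith
  have hLD : L.natDegree = D := expDegree_eq hF hQ
  have hexp : F = ∑ j ∈ Finset.range (D + 1), (hasseDeriv j L).eval u * P ^ j := by
    have h1 : (taylor u L).eval P = F := by
      rw [taylor_eval, hu, add_sub_cancel, hL, expPoly_eval hQ.1.1 hQ.1.2.1]
    conv_lhs => rw [← h1, eval_eq_sum_range, natDegree_taylor, hLD]
    simp only [taylor_coeff]
  set N : K[X][X] := ∑ j ∈ Finset.range (D + 1), monomial j ((hasseDeriv j L).eval u %ₘ P)
    with hN
  have hNcoeff : ∀ k, N.coeff k =
      if k ∈ Finset.range (D + 1) then (hasseDeriv k L).eval u %ₘ P else 0 := by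
    intro k
    rw [hN, finsetSum_coeff]
    simp only [coeff_monomial]
    exact Finset.sum_ite_eq' _ _ _
  have hNdeg : ∀ k, (N.coeff k).natDegree < P.natDegree := by
    intro k
    rw [hNcoeff]
    split_ifs
    · exact hPk.natDegree_modByMonic_lt _
    · simpa using hPk.natDegree_pos
  have hdiff : F - N.eval P = ∑ j ∈ Finset.range (D + 1), err j * P ^ j := by
    rw [hN, eval_finsetSum]
    conv_lhs => rw [hexp]
    rw [← Finset.sum_sub_distrib]
    refine Finset.sum_congr rfl fun j _ => ?_
    rw [eval_monomial, herr]
    ring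
  have htr : (supTrunc V n F : WithTop ℝ) < truncVal V P (F - N.eval P) := by
    rw [hdiff]
    exact AddValuation.map_lt_sum _ WithTop.coe_ne_top fun j _ => herrlt j
  -- `N` has coefficients of degree below `n`, so it is the `P`-expansion of `N(P)`; the bound on
  -- ν_P(F - N(P)) therefore passes to each difference of coefficients.
  have hco := htr.trans_le (hPk.truncVal_le_coeff i _)
  rw [expPoly_sub hPk.monic hPk.natDegree_pos, expPoly_eval_eq hPk.monic hPk.natDegree_pos hNdeg,
    coeff_sub, hNcoeff, if_pos (Finset.mem_range.2 (Nat.lt_succ_of_le hi))] at hco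
  have he := (herrlt i).trans_le (hPk.truncVal_le _)
  have heq : (expPoly P F).coeff i * P ^ i - (hasseDeriv i L).eval u * P ^ i =
      ((expPoly P F).coeff i - (hasseDeriv i L).eval u %ₘ P) * P ^ i - err i * P ^ i := by
    rw [herr]
    ring
  rw [heq]
  have hneg : (supTrunc V n F : WithTop ℝ) < restrict K V (-(err i * P ^ i)) := by
    rwa [AddValuation.map_neg]
  rw [sub_eq_add_neg]
  exact (restrict K V).map_lt_add hco hneg

/-- Comparison of the `i`-th term of the `P`-expansion of `F` with `β_i + i ν(P)`. -/
theorem map_coeff_eq_or (h : IsBoundedPlateau K V n) (hF : IsKeyPolynomialFor V n F)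
    (hb : IsBase (restrict K V) V n F Q₀ Q) (hP : P ∈ Psi K V n) (hlt : val V Q < val V P)
    {i : ℕ} (hi : i ≤ F.natDegree / n)
    (hbeta : beta (restrict K V) F Q i =
      restrict K V ((hasseDeriv i (expPoly Q F)).eval (Q - P))) :
    restrict K V ((expPoly P F).coeff i * P ^ i) =
        beta (restrict K V) F Q i + ((i * val V P : ℝ) : WithTop ℝ) ∨
      (supTrunc V n F : WithTop ℝ) < restrict K V ((expPoly P F).coeff i * P ^ i) ∧
        (supTrunc V n F : WithTop ℝ) <
          beta (restrict K V) F Q i + ((i * val V P : ℝ) : WithTop ℝ) := by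
  have := map_eq_or_lt_and_lt (restrict K V) (h.supTrunc_lt_map_sub hF hb hP hlt hi)
  rwa [h.map_mul_pow hP ((hasseDeriv i (expPoly Q F)).eval (Q - P)), ← hbeta] at this

end IsBoundedPlateau

end Base

/-! ### Stabilisation of J_P(F), and which terms may be omitted. -/

section Main

variable {K E : Type*} [Field K] [Field E] [Algebra K E]
  {V : AddValuation E[X] (WithTop ℝ)} {n : ℕ} {F H Q₀ Q P : K[X]}

theorem sub_truncExpansion (hP : P ∈ Psi K V n) (hD : 1 ≤ expDegree P F) {S : Finset ℕ}
    (hS : S ⊆ Finset.Ico 1 (expDegree P F)) :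
    F - truncExpansion F P S =
      ∑ j ∈ Finset.Ico 1 (expDegree P F) \ S, (expPoly P F).coeff j * P ^ j := by
  have hexp : F = (expPoly P F).coeff 0 +
      ∑ j ∈ Finset.Ico 1 (expDegree P F), (expPoly P F).coeff j * P ^ j +
        (expPoly P F).coeff (expDegree P F) * P ^ expDegree P F := by
    conv_lhs => rw [← expPoly_eval hP.1.1 hP.1.2.1 F, eval_eq_sum_range,
      Finset.sum_range_succ, Finset.range_eq_Ico,
      Finset.sum_eq_sum_Ico_succ_bot (show 0 < (expPoly P F).natDegree from hD)]
    rw [pow_zero, mul_one]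
    rfl
  rw [truncExpansion]
  conv_lhs => enter [1]; rw [hexp]
  rw [← Finset.sum_sdiff hS]
  ring

theorem natDegree_sum_sdiff_lt (hP : P ∈ Psi K V n) (hF : F ≠ 0) (hD : 1 ≤ F.natDegree / n)
    (S : Finset ℕ) :
    (∑ j ∈ Finset.Ico 1 (expDegree P F) \ S, (expPoly P F).coeff j * P ^ j).natDegree <
      F.natDegree := by
  have hn : 0 < n := hP.2 ▸ hP.1.2.1
  have hDn : F.natDegree / n * n ≤ F.natDegree := Nat.div_mul_le_self _ _
  have hpos : 0 < F.natDegree := lt_of_lt_of_le (by positivity) hDn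
  refine lt_of_le_of_lt (natDegree_sum_le_of_forall_le (n := F.natDegree - 1) _ _ ?_) (by omega)
  intro j hj
  rw [Finset.mem_sdiff, Finset.mem_Ico, expDegree_eq hP.1.1 hP.1.2.1 hF, hP.2] at hj
  have h1 := natDegree_mul_le (p := (expPoly P F).coeff j) (q := P ^ j)
  have h2 := natDegree_pow_le (p := P) (n := j)
  have h3 := natDegree_coeff_expPoly_lt hP.1.1 hP.1.2.1 F j
  rw [hP.2] at h2 h3
  have h4 : (j + 1) * n ≤ F.natDegree / n * n := Nat.mul_le_mul_right _ hj.1.2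
  rw [add_mul, one_mul] at h4
  omega

namespace IsBoundedPlateau

/-- A property of the members of `Ψ_n` of large value holds along every cofinal family. -/
theorem exists_forall_ge (h : IsBoundedPlateau K V n) {ι : Type*} [LinearOrder ι] {q : ι → K[X]}
    (hq : IsCofinalFamily (restrict K V) V n Q q) {p : K[X] → Prop}
    (hp : ∀ᶠ P in plateauFilter K V n, p P) : ∃ ρ₀, ∀ ρ, ρ₀ ≤ ρ → p (q ρ) := by
  obtain ⟨R, hR, hp⟩ := h.eventually_iff.1 hp
  obtain ⟨-, hmem, hmono, -, hcof⟩ := hq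
  obtain ⟨ρ₀, hρ₀⟩ := hcof R hR
  exact ⟨ρ₀, fun ρ hρ => hp _ (hmem ρ)
    ((h.val_le_iff hR (hmem ρ)).2 (hρ₀.trans (hmono.monotone hρ)))⟩

theorem nsmul_map (h : IsBoundedPlateau K V n) (hP : P ∈ Psi K V n) (i : ℕ) :
    i • restrict K V P = ((i * val V P : ℝ) : WithTop ℝ) := by
  rw [← h.coe_val hP, ← WithTop.coe_nsmul, nsmul_eq_mul]

/-- Two lines of different slopes meet at most once, so beyond a coincidence there is no other. -/
theorem eventually_add_ne (h : IsBoundedPlateau K V n) {x y : WithTop ℝ} {j k : ℕ} (hjk : j < k)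
    (hxy : x ≠ ⊤ ∨ y ≠ ⊤) :
    ∀ᶠ P in plateauFilter K V n,
      x + j • restrict K V P ≠ y + k • restrict K V P := by
  by_cases hex : ∃ R ∈ Psi K V n, x + j • restrict K V R = y + k • restrict K V R
  · obtain ⟨R, hR, he⟩ := hex
    filter_upwards [h.eventually_lt hR, h.eventually_mem] with P hlt hP hne
    rw [h.nsmul_map hP, h.nsmul_map hP] at hne
    rw [h.nsmul_map hR, h.nsmul_map hR] at he
    have hx : x ≠ ⊤ := by
      rintro rfl
      rw [top_add, eq_comm, WithTop.add_eq_top] at he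
      rcases he with he | he
      · exact hxy.elim (fun h => h rfl) (fun h => h he)
      · exact WithTop.coe_ne_top he
    have hy : y ≠ ⊤ := by
      rintro rfl
      rw [top_add, WithTop.add_eq_top] at he
      exact he.elim hx WithTop.coe_ne_top
    lift x to ℝ using hx
    lift y to ℝ using hy
    rw [← WithTop.coe_add, ← WithTop.coe_add, WithTop.coe_inj] at he hne
    have hjk' : (j : ℝ) < k := by exact_mod_cast hjk
    nlinarith
  · push Not at hex
    filter_upwards [h.eventually_mem] with P hP using hex P hP

variable [IsAlgClosed E]

theorem mem_J_iff (h : IsBoundedPlateau K V n) (hF : IsKeyPolynomialFor V n F)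
    (hP : P ∈ Psi K V n) {i : ℕ} : i ∈ J (restrict K V) V n F P ↔
      (1 ≤ i ∧ i ≤ F.natDegree / n) ∧
        (supTrunc V n F : WithTop ℝ) < restrict K V ((expPoly P F).coeff i * P ^ i) := by
  rw [J, Finset.mem_filter, Finset.mem_Icc, h.limitTrunc_eq hF.1.1.ne_zero, expDegree_eq hF hP,
    ← toE_coe, gt_iff_lt, toE_lt_toE]

theorem mem_Bset_iff (h : IsBoundedPlateau K V n) (hF : IsKeyPolynomialFor V n F)
    (hP : P ∈ Psi K V n) {i : ℕ} : i ∈ Bset (restrict K V) V n F P ↔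
      (1 ≤ i ∧ i < F.natDegree / n) ∧
        restrict K V ((expPoly P F).coeff i * P ^ i) ≤ (supTrunc V n F : WithTop ℝ) := by
  rw [Bset, Finset.mem_sdiff, Finset.mem_Ico, h.mem_J_iff hF hP, expDegree_eq hF hP]
  constructor
  · rintro ⟨h1, h2⟩
    exact ⟨h1, not_lt.1 fun h3 => h2 ⟨⟨h1.1, h1.2.le⟩, h3⟩⟩
  · rintro ⟨h1, h2⟩
    exact ⟨h1, fun h3 => absurd h3.2 (not_lt.2 h2)⟩

/-- Turns membership in J_P(F) into a condition monotone in ν(P), because β_i does not depend on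
`P`. -/
theorem mem_J_iff_beta (h : IsBoundedPlateau K V n) (hF : IsKeyPolynomialFor V n F)
    (hb : IsBase (restrict K V) V n F Q₀ Q) (hP : P ∈ Psi K V n) (hlt : val V Q < val V P)
    {i : ℕ} (hi : 1 ≤ i) (hi' : i ≤ F.natDegree / n)
    (hbeta : beta (restrict K V) F Q i =
      restrict K V ((hasseDeriv i (expPoly Q F)).eval (Q - P))) :
    i ∈ J (restrict K V) V n F P ↔ (supTrunc V n F : WithTop ℝ) <
      beta (restrict K V) F Q i + ((i * val V P : ℝ) : WithTop ℝ) := by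
  rw [h.mem_J_iff hF hP]
  rcases h.map_coeff_eq_or hF hb hP hlt hi' hbeta with he | he
  · rw [he]
    exact ⟨fun hx => hx.2, fun hx => ⟨⟨hi, hi'⟩, hx⟩⟩
  · exact ⟨fun _ => he.2, fun _ => ⟨⟨hi, hi'⟩, he.1⟩⟩

theorem eventually_forall_beta_eq (h : IsBoundedPlateau K V n) (hF : IsKeyPolynomialFor V n F)
    (hb : IsBase (restrict K V) V n F Q₀ Q) :
    ∀ᶠ P in plateauFilter K V n, ∀ i ∈ Finset.Icc 1 (F.natDegree / n),
      beta (restrict K V) F Q i =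
        restrict K V ((hasseDeriv i (expPoly Q F)).eval (Q - P)) := by
  rw [Filter.eventually_all_finset]
  exact fun i hi => h.eventually_beta_eq hF hb (Finset.mem_Icc.1 hi).1

/-- The sets `J_P(F)` are constant for `P` of large value. -/
theorem exists_eventually_J_eq (h : IsBoundedPlateau K V n) (hF : IsKeyPolynomialFor V n F)
    (hb : IsBase (restrict K V) V n F Q₀ Q) :
    ∃ T : Finset ℕ, ∀ᶠ P in plateauFilter K V n, J (restrict K V) V n F P = T := by
  classical
  have hQ := hb.2.1
  set c : ℕ → K[X] → Prop := fun i P => (supTrunc V n F : WithTop ℝ) <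
    beta (restrict K V) F Q i + ((i * val V P : ℝ) : WithTop ℝ) with hc
  -- By monotonicity the condition holds eventually as soon as it holds for one member of Ψ_n.
  refine ⟨(Finset.Icc 1 (F.natDegree / n)).filter fun i => ∃ P ∈ Psi K V n, c i P, ?_⟩
  have hev : ∀ᶠ P in plateauFilter K V n, ∀ i ∈ Finset.Icc 1 (F.natDegree / n),
      (c i P ↔ ∃ P ∈ Psi K V n, c i P) := by
    rw [Filter.eventually_all_finset]
    intro i _
    by_cases hex : ∃ P ∈ Psi K V n, c i P
    · obtain ⟨R, hR, hcR⟩ := hex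
      filter_upwards [h.eventually_lt hR] with P hlt
      refine iff_of_true (hcR.trans_le ?_) ⟨R, hR, hcR⟩
      gcongr
      exact WithTop.coe_le_coe.2 (mul_le_mul_of_nonneg_left hlt.le (Nat.cast_nonneg _))
    · filter_upwards [h.eventually_mem] with P hP
      exact iff_of_false (fun hcP => hex ⟨P, hP, hcP⟩) hex
  filter_upwards [hev, h.eventually_forall_beta_eq hF hb, h.eventually_lt hQ, h.eventually_mem]
    with P h1 h2 hlt hP
  ext i
  rw [Finset.mem_filter]
  constructor
  · intro hi
    have hi' := Finset.mem_Icc.2 ((h.mem_J_iff hF hP).1 hi).1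
    refine ⟨hi', (h1 i hi').1 ?_⟩
    rw [Finset.mem_Icc] at hi'
    exact (h.mem_J_iff_beta hF hb hP hlt hi'.1 hi'.2 (h2 i (Finset.mem_Icc.2 hi'))).1 hi
  · rintro ⟨hi', hi⟩
    have hi'' := Finset.mem_Icc.1 hi'
    exact (h.mem_J_iff_beta hF hb hP hlt hi''.1 hi''.2 (h2 i hi')).2 ((h1 i hi').2 hi)

theorem exists_isThreshold (h : IsBoundedPlateau K V n) (hF : IsKeyPolynomialFor V n F)
    (hb : IsBase (restrict K V) V n F Q₀ Q) {ι : Type*} [LinearOrder ι] {q : ι → K[X]}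
    (hq : IsCofinalFamily (restrict K V) V n Q q) :
    ∃ ρ₁, IsThreshold (restrict K V) V n F Q q ρ₁ := by
  obtain ⟨T, hT⟩ := h.exists_eventually_J_eq hF hb
  have hne : ∀ᶠ P in plateauFilter K V n, ∀ j ∈ Finset.Icc 1 (F.natDegree / n),
      ∀ k ∈ Finset.Icc 1 (F.natDegree / n), j < k →
        (beta (restrict K V) F Q j ≠ ⊤ ∨ beta (restrict K V) F Q k ≠ ⊤) →
        beta (restrict K V) F Q j + j • restrict K V P ≠
          beta (restrict K V) F Q k + k • restrict K V P := by
    simp only [Filter.eventually_all_finset, Filter.eventually_all]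
    exact fun j _ k _ hjk hxy => h.eventually_add_ne hjk hxy
  obtain ⟨ρ₀, hρ₀⟩ := h.exists_forall_ge hq ((h.eventually_forall_beta_eq hF hb).and hne)
  obtain ⟨ρ₂, hρ₂⟩ := h.exists_forall_ge hq hT
  have hD : expDegree Q F = F.natDegree / n := expDegree_eq hF hb.2.1
  refine ⟨max ρ₀ ρ₂, ⟨ρ₀, le_max_left _ _, fun ρ hρ i hi hi' => ?_,
    fun ρ hρ j k hj hjk hk => ?_⟩, fun ρ hρ => ?_⟩
  · exact (hρ₀ ρ hρ).1 i (Finset.mem_Icc.2 ⟨hi, hD ▸ hi'⟩)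
  · rw [hD] at hk
    exact (hρ₀ ρ hρ).2 j (Finset.mem_Icc.2 ⟨hj, hjk.le.trans hk⟩) k
      (Finset.mem_Icc.2 ⟨hj.trans hjk.le, hk⟩) hjk
  · rw [hρ₂ ρ ((le_max_right _ _).trans hρ), hρ₂ _ (le_max_right _ _)]

/-- Membership in B_n(F) gives only ≤ B̄. The bound β_i + iν(P') ≤ B̄ persists for larger `P'`, and
`i ≥ 1` makes this expression strictly increasing, so it is strict at `P`. -/
theorem eventually_map_lt (h : IsBoundedPlateau K V n) (hF : IsKeyPolynomialFor V n F)
    (hb : IsBase (restrict K V) V n F Q₀ Q) :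
    ∀ᶠ P in plateauFilter K V n, ∀ i ∈ Bset (restrict K V) V n F P,
      restrict K V ((expPoly P F).coeff i * P ^ i) < supTrunc V n F := by
  obtain ⟨T, hT⟩ := h.exists_eventually_J_eq hF hb
  obtain ⟨R, hR, hall⟩ := h.eventually_iff.1 ((hT.and (h.eventually_forall_beta_eq hF hb)).and
    (h.eventually_lt hb.2.1))
  refine h.eventually_iff.2 ⟨R, hR, fun P hP hle i hi => ?_⟩
  obtain ⟨⟨hJ, hbeta⟩, hlt⟩ := hall P hP hle
  obtain ⟨P', hP', hPP'⟩ := h.exists_val_lt hP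
  obtain ⟨⟨hJ', hbeta'⟩, hlt'⟩ := hall P' hP' (hle.trans hPP'.le)
  have hi' := (h.mem_Bset_iff hF hP).1 hi
  rw [Bset, Finset.mem_sdiff, hJ, ← hJ'] at hi
  have hiD := Finset.mem_Icc.2 ⟨hi'.1.1, hi'.1.2.le⟩
  have h1 := hi.2
  rw [h.mem_J_iff_beta hF hb hP' hlt' hi'.1.1 hi'.1.2.le (hbeta' i hiD), not_lt] at h1
  rcases h.map_coeff_eq_or hF hb hP hlt hi'.1.2.le (hbeta i hiD) with he | he
  · rw [he]
    have hi0 : (0 : ℝ) < i := by exact_mod_cast hi'.1.1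
    refine lt_of_lt_of_le (WithTop.add_lt_add_left ?_
      (WithTop.coe_lt_coe.2 (mul_lt_mul_of_pos_left hPP' hi0))) h1
    rintro htop
    rw [htop, top_add] at h1
    exact WithTop.coe_ne_top (top_le_iff.1 h1)
  · exact absurd he.1 (not_lt.2 hi'.2)

/-- Far out, every term of the `P`-expansion of `F - H` has value at least B̄, so a term of `F`
below B̄ forces the corresponding term of `H` below B̄. -/
theorem eventually_Bset_subset (h : IsBoundedPlateau K V n) (hF : IsKeyPolynomialFor V n F)
    (hH : IsKeyPolynomialFor V n H) (hb : IsBase (restrict K V) V n F Q₀ Q) :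
    ∀ᶠ P in plateauFilter K V n,
      Bset (restrict K V) V n F P ⊆ Bset (restrict K V) V n H P := by
  filter_upwards [h.eventually_map_lt hF hb, h.eventually_eps_lt hF (natDegree_sub_lt hF hH),
    h.eventually_mem] with P hP1 heps hP i hi
  have hd := natDegree_eq_of_isKeyPolynomialFor hF hH
  have hi' := (h.mem_Bset_iff hF hP).1 hi
  have hlt := hP1 i hi
  refine (h.mem_Bset_iff hH hP).2 ⟨hd ▸ hi'.1, ?_⟩
  have hPk := h.isFiniteKey hP
  have h1 := h.supTrunc_le_map_sub hF hH
  rw [← hPk.truncVal_eq heps.le] at h1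
  have h2 := h1.trans (hPk.truncVal_le_coeff i _)
  rw [expPoly_sub hPk.monic hPk.natDegree_pos, coeff_sub, sub_mul] at h2
  rw [← h.supTrunc_eq hF hH]
  by_contra hc
  rw [not_le] at hc
  have h3 := (restrict K V).map_le_add h2 hc.le
  rw [sub_add_cancel] at h3
  exact absurd hlt (not_lt.2 h3)

theorem eventually_Bset_eq (h : IsBoundedPlateau K V n) (hF : IsKeyPolynomialFor V n F)
    (hb : IsBase (restrict K V) V n F Q₀ Q) {ι : Type*} [LinearOrder ι] {q : ι → K[X]}
    (hq : IsCofinalFamily (restrict K V) V n Q q) {ρ₁ : ι}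
    (hρ₁ : IsThreshold (restrict K V) V n F Q q ρ₁) :
    ∀ᶠ P in plateauFilter K V n,
      Bset (restrict K V) V n F P = Bset (restrict K V) V n F (q ρ₁) := by
  obtain ⟨T, hT⟩ := h.exists_eventually_J_eq hF hb
  obtain ⟨ρ, hρ⟩ := h.exists_forall_ge hq hT
  have hT' : J (restrict K V) V n F (q ρ₁) = T := by
    rw [← hρ₁.2 _ (le_max_left ρ₁ ρ), hρ _ (le_max_right _ _)]
  filter_upwards [hT, h.eventually_mem] with P hJ hP
  rw [Bset, Bset, hJ, hT', expDegree_eq hF hP, expDegree_eq hF (hq.2.1 ρ₁)]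

/-- Omitting the terms with exponents in `J_P(F)` gives a limit key polynomial. -/
theorem isKeyPolynomialFor_truncExpansion (h : IsBoundedPlateau K V n)
    (hF : IsKeyPolynomialFor V n F) (hP : P ∈ Psi K V n) :
    IsKeyPolynomialFor V n (truncExpansion F P (Bset (restrict K V) V n F P)) := by
  have hF0 : F ≠ 0 := hF.1.1.ne_zero
  have hD := h.one_le_degree_div hF
  have hsub := sub_truncExpansion (F := F) hP (by rwa [expDegree_eq hF hP])
    (S := Bset (restrict K V) V n F P) Finset.sdiff_subset
  have hdeg := natDegree_sum_sdiff_lt hP hF0 hD (Bset (restrict K V) V n F P)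
  rw [← hsub] at hdeg
  set G := truncExpansion F P (Bset (restrict K V) V n F P) with hG
  have hGF : G = F - (F - G) := by ring
  have hlt : ∀ P' ∈ Psi K V n, val V P ≤ val V P' →
      (supTrunc V n F : WithTop ℝ) < truncVal V P' (F - G) := by
    intro P' hP' hle
    rw [hsub]
    refine AddValuation.map_lt_sum _ WithTop.coe_ne_top fun j hj => ?_
    refine lt_of_lt_of_le ?_ (h.truncVal_mono hP hP' hle _)
    rw [(h.isFiniteKey hP).truncVal_mul_pow (natDegree_coeff_expPoly_lt hP.1.1 hP.1.2.1 F j)]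
    rw [Finset.mem_sdiff, Finset.mem_Ico, h.mem_Bset_iff hF hP, expDegree_eq hF hP] at hj
    exact not_le.1 fun hle' => hj.2 ⟨hj.1, hle'⟩
  refine h.isKeyPolynomialFor_of_eps_lt hF ?_ ?_ fun R hR => ?_
  · rw [hGF]
    exact hF.1.1.sub_of_left (degree_lt_degree hdeg)
  · rw [hGF]
    exact natDegree_sub_eq_left_of_natDegree_lt hdeg
  -- If ε(G) ≤ ε(R), then at `P'` beyond both `P` and `R` one gets ν(G) = ν_{P'}(G) = ν_{P'}(F) <
  -- B̄, against ν(G) ≥ B̄.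
  · by_contra hle
    rw [not_lt] at hle
    obtain ⟨P', hP', h1, h2⟩ : ∃ P' ∈ Psi K V n, val V P ≤ val V P' ∧ val V R ≤ val V P' := by
      rcases le_total (val V P) (val V R) with h0 | h0
      · exact ⟨R, hR, h0, le_rfl⟩
      · exact ⟨P, hP, le_rfl, h0⟩
    have hk := h.isFiniteKey hP'
    have h3 : truncVal V P' G = restrict K V G :=
      hk.truncVal_eq (hle.trans ((h.eps_le_eps_iff hR hP').2 h2))
    have h4 : truncVal V P' F < supTrunc V n F := by
      rw [← coe_truncReal hF0]
      exact WithTop.coe_lt_coe.2 (h.truncReal_lt_supTrunc hF hP')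
    have h5 := hlt P' hP' h1
    have h6 : truncVal V P' G = truncVal V P' F := by
      rw [hGF]
      exact AddValuation.map_sub_eq_of_lt_left _ (h4.trans h5)
    have h7 : (supTrunc V n F : WithTop ℝ) ≤ restrict K V G := by
      rw [hGF]
      exact AddValuation.map_le_sub _ (h.supTrunc_le_map hF) (h5.le.trans (hk.truncVal_le _))
    rw [← h3, h6] at h7
    exact absurd h4 (not_lt.2 h7)

/-- No term with exponent in `B_n(F)` can be omitted. -/
theorem eq_Bset_of_isKeyPolynomialFor (h : IsBoundedPlateau K V n)
    (hF : IsKeyPolynomialFor V n F) (hb : IsBase (restrict K V) V n F Q₀ Q) {ι : Type*}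
    [LinearOrder ι] {q : ι → K[X]} (hq : IsCofinalFamily (restrict K V) V n Q q) {ρ₁ ρ : ι}
    (hρ₁ : IsThreshold (restrict K V) V n F Q q ρ₁) (hρ : ρ₁ ≤ ρ) {S : Finset ℕ}
    (hS : S ⊆ Bset (restrict K V) V n F (q ρ))
    (hFS : IsKeyPolynomialFor V n (truncExpansion F (q ρ) S)) :
    S = Bset (restrict K V) V n F (q ρ) := by
  by_contra hne
  obtain ⟨-, hmem, hmono, hgt, hcof⟩ := hq
  obtain ⟨⟨ρ₀, hρ₀, hβ, hdist⟩, hJ⟩ := hρ₁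
  have hP := hmem ρ
  have hDQ : expDegree Q F = F.natDegree / n := expDegree_eq hF hb.2.1
  have hDP : expDegree (q ρ) F = F.natDegree / n := expDegree_eq hF hP
  have hPlt := (h.val_lt_iff hb.2.1 hP).2 (hgt ρ)
  have hsub := sub_truncExpansion (F := F) hP (by rw [hDP]; exact h.one_le_degree_div hF)
    (hS.trans Finset.sdiff_subset)
  have hle := h.supTrunc_le_map_sub hF hFS
  rw [hsub] at hle
  set t : ℕ → WithTop ℝ := fun j => restrict K V ((expPoly (q ρ) F).coeff j * q ρ ^ j) with ht
  have hB : ∀ j ∈ Bset (restrict K V) V n F (q ρ), t j < supTrunc V n F ∧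
      t j = beta (restrict K V) F Q j + j • restrict K V (q ρ) := by
    intro j hj
    have hj' := (h.mem_Bset_iff hF hP).1 hj
    obtain ⟨P', hP', hPP'⟩ := h.exists_val_lt hP
    obtain ⟨ρ', hρ'⟩ := hcof P' hP'
    have hlt : val V (q ρ) < val V (q ρ') :=
      hPP'.trans_le ((h.val_le_iff hP' (hmem ρ')).2 hρ')
    have hρρ' : ρ < ρ' := hmono.lt_iff_lt.1 ((h.val_lt_iff hP (hmem ρ')).1 hlt)
    rw [Bset, Finset.mem_sdiff, hJ ρ hρ, ← hJ ρ' (hρ.trans hρρ'.le),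
      h.mem_J_iff_beta hF hb (hmem ρ') (hPlt.trans hlt) hj'.1.1 hj'.1.2.le
        (hβ ρ' (hρ₀.trans (hρ.trans hρρ'.le)) j hj'.1.1 (hDQ ▸ hj'.1.2.le)), not_lt] at hj
    rw [h.nsmul_map hP]
    rcases h.map_coeff_eq_or hF hb hP hPlt hj'.1.2.le
      (hβ ρ (hρ₀.trans hρ) j hj'.1.1 (hDQ ▸ hj'.1.2.le)) with he | he
    · refine ⟨?_, he⟩
      rw [ht]
      simp only
      rw [he]
      have hi0 : (0 : ℝ) < j := by exact_mod_cast hj'.1.1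
      refine lt_of_lt_of_le (WithTop.add_lt_add_left ?_
        (WithTop.coe_lt_coe.2 (mul_lt_mul_of_pos_left hlt hi0))) hj.2
      rintro htop
      rw [htop, top_add] at hj
      exact WithTop.coe_ne_top (top_le_iff.1 hj.2)
    · exact absurd he.1 (not_lt.2 hj'.2)
  have hT : (Bset (restrict K V) V n F (q ρ) \ S).Nonempty := by
    rw [Finset.sdiff_nonempty]
    exact fun hsup => hne (Finset.Subset.antisymm hS hsup)
  -- The minimum over the wrongly omitted exponents is attained only once, because the values β_j +
  -- jγ_ρ are distinct; the other omitted terms lie above B̄. So the whole difference has the value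
  -- of this single term, which is below B̄.
  obtain ⟨j₀, hj₀, hmin⟩ := Finset.exists_min_image _ t hT
  rw [Finset.mem_sdiff] at hj₀
  have hj₀B := hB j₀ hj₀.1
  have hj₀I := (h.mem_Bset_iff hF hP).1 hj₀.1
  have hj₀m : j₀ ∈ Finset.Ico 1 (expDegree (q ρ) F) \ S :=
    Finset.mem_sdiff.2 ⟨Finset.mem_Ico.2 (hDP ▸ hj₀I.1), hj₀.2⟩
  rw [← Finset.add_sum_erase _ _ hj₀m, AddValuation.map_add_eq_of_lt_left] at hle
  · exact absurd hj₀B.1 (not_lt.2 hle)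
  · refine AddValuation.map_lt_sum _ (ne_top_of_lt hj₀B.1) fun j hj => ?_
    rw [Finset.mem_erase, Finset.mem_sdiff] at hj
    obtain ⟨hjne, hjI, hjS⟩ := hj
    rw [Finset.mem_Ico, hDP] at hjI
    by_cases hjB : j ∈ Bset (restrict K V) V n F (q ρ)
    · refine lt_of_le_of_ne (hmin j (Finset.mem_sdiff.2 ⟨hjB, hjS⟩)) fun heq => ?_
      have hjv := hB j hjB
      have hfin : ∀ k, t k < supTrunc V n F ∧
          t k = beta (restrict K V) F Q k + k • restrict K V (q ρ) →
          beta (restrict K V) F Q k ≠ ⊤ := by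
        rintro k ⟨h1, h2⟩ htop
        rw [h2, htop, top_add] at h1
        exact not_top_lt h1
      change t j₀ = t j at heq
      rw [hj₀B.2, hjv.2] at heq
      rcases lt_or_gt_of_ne hjne with hlt | hlt
      · exact hdist ρ (hρ₀.trans hρ) j j₀ hjI.1 hlt (hDQ ▸ hj₀I.1.2.le)
          (Or.inl (hfin j hjv)) heq.symm
      · exact hdist ρ (hρ₀.trans hρ) j₀ j hj₀I.1.1 hlt (hDQ ▸ hjI.2.le)
          (Or.inl (hfin j₀ hj₀B)) heq
    · refine hj₀B.1.trans (not_le.1 fun hle' => hjB ?_)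
      exact (h.mem_Bset_iff hF hP).2 ⟨hjI, hle'⟩

end IsBoundedPlateau

end Main

end LimitKey

theorem proposition3p6 {K L Kbar : Type*} [Field K] [Field L] [Algebra K L] [FiniteDimensional K L]
    [Field Kbar] [Algebra K Kbar] [IsAlgClosure K Kbar]
    (η : L) (hη : IntermediateField.adjoin K {η} = ⊤)
    (v : AddValuation L (WithTop ℝ)) (hv : ∃ y : L, v y ≠ 0 ∧ v y ≠ ⊤)
    (ν : AddValuation K[X] (WithTop ℝ)) (hν : ν = LimitKey.inducedVal v η)
    (νbar : AddValuation Kbar[X] (WithTop ℝ))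
    (hνbar : ∀ f : K[X], νbar (f.map (algebraMap K Kbar)) = ν f)
    (n : ℕ) (hplateau : LimitKey.IsPlateau ν νbar n)
    (hbdd : LimitKey.IsBoundedIn ν νbar n (LimitKey.divisibleClosure v))
    (F : K[X]) (hF : LimitKey.IsLimitKeyPolynomial ν νbar n F)
    {ι κ : Type*} [LinearOrder ι] [LinearOrder κ] :
    -- the choices of `Q` and of `ρ₁` are possible
    (∀ Q₀ ∈ LimitKey.Psi K νbar n, ∃ Q, LimitKey.IsBase ν νbar n F Q₀ Q) ∧
    (∀ (Q₀ Q : K[X]) (q : ι → K[X]), LimitKey.IsBase ν νbar n F Q₀ Q →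
      LimitKey.IsCofinalFamily ν νbar n Q q →
      ∃ ρ₁, LimitKey.IsThreshold ν νbar n F Q q ρ₁) ∧
    -- for all such choices, `F_{S,ρ}` is a limit key polynomial if and only if `S = B_n(F)`
    (∀ (Q₀ Q : K[X]) (q : ι → K[X]) (ρ₁ : ι), LimitKey.IsBase ν νbar n F Q₀ Q →
      LimitKey.IsCofinalFamily ν νbar n Q q → LimitKey.IsThreshold ν νbar n F Q q ρ₁ →
      ∀ ρ, ρ₁ ≤ ρ → ∀ S : Finset ℕ, S ⊆ LimitKey.Bset ν νbar n F (q ρ₁) →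
        (LimitKey.IsLimitKeyPolynomial ν νbar n (LimitKey.truncExpansion F (q ρ) S) ↔
          S = LimitKey.Bset ν νbar n F (q ρ₁))) ∧
    -- `B_n(F)` depends neither on the limit key polynomial `F` nor on the choices
    (∀ (H : K[X]), LimitKey.IsLimitKeyPolynomial ν νbar n H →
      ∀ (Q₀ Q : K[X]) (q : ι → K[X]) (ρ₁ : ι), LimitKey.IsBase ν νbar n F Q₀ Q →
      LimitKey.IsCofinalFamily ν νbar n Q q → LimitKey.IsThreshold ν νbar n F Q q ρ₁ →
      ∀ (Q₀' Q' : K[X]) (q' : κ → K[X]) (ρ₁' : κ), LimitKey.IsBase ν νbar n H Q₀' Q' →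
      LimitKey.IsCofinalFamily ν νbar n Q' q' → LimitKey.IsThreshold ν νbar n H Q' q' ρ₁' →
      LimitKey.Bset ν νbar n F (q ρ₁) = LimitKey.Bset ν νbar n H (q' ρ₁')) := by
  have : IsAlgClosed Kbar := IsAlgClosure.isAlgClosed K
  obtain rfl : ν = LimitKey.restrict K νbar :=
    AddValuation.ext fun f => by rw [← hνbar, LimitKey.restrict_apply]
  have h : LimitKey.IsBoundedPlateau K νbar n :=
    ⟨hplateau, hbdd.imp fun _ hγ => hγ.2⟩
  have hF' := hF.2
  refine ⟨fun Q₀ hQ₀ => h.exists_isBase hF' hQ₀, fun Q₀ Q q hb hq => h.exists_isThreshold hF' hb hq,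
    fun Q₀ Q q ρ₁ hb hq hρ₁ ρ hρ S hS => ?_,
    fun H hH Q₀ Q q ρ₁ hb hq hρ₁ Q₀' Q' q' ρ₁' hb' hq' hρ₁' => ?_⟩
  · have hB : LimitKey.Bset (LimitKey.restrict K νbar) νbar n F (q ρ₁) =
        LimitKey.Bset (LimitKey.restrict K νbar) νbar n F (q ρ) := by
      rw [LimitKey.Bset, LimitKey.Bset, hρ₁.2 ρ hρ,
        LimitKey.IsBoundedPlateau.expDegree_eq hF' (hq.2.1 ρ),
        LimitKey.IsBoundedPlateau.expDegree_eq hF' (hq.2.1 ρ₁)]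
    rw [hB] at hS ⊢
    refine ⟨fun hlim => h.eq_Bset_of_isKeyPolynomialFor hF' hb hq hρ₁ hρ hS hlim.2, ?_⟩
    rintro rfl
    exact ⟨hplateau, h.isKeyPolynomialFor_truncExpansion hF' (hq.2.1 ρ)⟩
  -- All four properties hold for every `P` of large value, so one `P` serves for both families,
  -- although their index sets are unrelated.
  · obtain ⟨P, -, ⟨⟨h1, h2⟩, h3⟩, h4⟩ := h.exists_of_eventually
      (((h.eventually_Bset_subset hF' hH.2 hb).and (h.eventually_Bset_subset hH.2 hF' hb')).and
        (h.eventually_Bset_eq hF' hb hq hρ₁) |>.and (h.eventually_Bset_eq hH.2 hb' hq' hρ₁'))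
    rw [← h3, ← h4]
    exact Finset.Subset.antisymm h1 h2
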